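/- Let $\mathcal{H}_1,\mathcal{H}_2$ be separable complex Hilbert spaces, let $\mathcal{T}(\mathcal{H}_k)$ be the Banach space of trace-class operators (trace norm), $\mathcal{L}(\mathcal{H}_k)$ the bounded operators and $\mathcal{S}(\mathcal{H}_k)$ the density operators (positive trace-class operators of trace one), and write $\langle T,a\rangle=\operatorname{Tr}\{Ta\}$. Let $(\Omega,\mathcal{F},Q)$ be a complete $\sigma$-finite measure space. Let $\mathcal{I}$ be an instrument on $(\Omega,\mathcal{F})$: for each $F\in\mathcal{F}$, $\mathcal{I}(F):\mathcal{T}(\mathcal{H}_1)\to\mathcal{T}(\mathcal{H}_2)$ is a bounded, completely positive linear map, $\operatorname{Tr}\{\mathcal{I}(\Omega)[\rho]\}=\operatorname{Tr}\{\rho\}$ for all $\rho\in\mathcal{T}(\mathcal{H}_1)$, and $\sum_i\langle\mathcal{I}(F_i)[\rho],a\rangle=\langle\mathcal{I}(\bigcup_iF_i)[\rho],a\rangle$ for all countable families of pairwise disjoint $F_i\in\mathcal{F}$, all $\rho\in\mathcal{T}(\mathcal{H}_1)$ and all $a\in\mathcal{L}(\mathcal{H}_2)$. For $\rho\in\mathcal{S}(\mathcal{H}_1)$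 let $P_\rho$ be the probability measure $P_\rho(F)=\operatorname{Tr}\{\mathcal{I}(F)[\rho]\}$, and assume $P_\rho\ll Q$ for all $\rho\in\mathcal{S}(\mathcal{H}_1)$. A family of a posteriori states for $(\rho,\mathcal{I})$ is a measurable function $\pi_\rho:\Omega\to\mathcal{S}(\mathcal{H}_2)$ such that $$\int_F\pi_\rho(\omega)\,P_\rho(\mathrm{d}\omega)=\mathcal{I}(F)[\rho]\quad\text{for all }F\in\mathcal{F}\quad\text{(Bochner integral in }\mathcal{T}(\mathcal{H}_2)).$$ Then: 1. For every $\rho\in\mathcal{S}(\mathcal{H}_1)$ there exists a family of a posteriori states for $(\rho,\mathcal{I})$, and any two such families are equal $P_\rho$-almost surely. 2. There is exactly one bounded linear map $\Lambda_{\mathcal{I}}:\mathcal{T}(\mathcal{H}_1)\to L^1(\Omega,\mathcal{F},Q;\mathcal{T}(\mathcal{H}_2))$ which is the preadjoint of the channel associated with $\mathcal{I}$, i.e. which is completely positive, satisfies $\int_\Omega\operatorname{Tr}\{\Lambda_{\mathcal{I}}[\rho](\omega)\}\,Q(\mathrm{d}\omega)=\operatorname{Tr}\{\rho\}$ for all $\rho\in\mathcal{T}(\mathcal{H}_1)$,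 and satisfies $$\int_\Omega f(\omega)\,\langle\Lambda_{\mathcal{I}}[\rho](\omega),a\rangle\,Q(\mathrm{d}\omega)=\int_\Omega f(\omega)\,\langle\mathcal{I}(\mathrm{d}\omega)[\rho],a\rangle$$ for all $\rho\in\mathcal{T}(\mathcal{H}_1)$, $a\in\mathcal{L}(\mathcal{H}_2)$, $f\in L^\infty(\Omega,\mathcal{F},Q)$. 3. For every $\rho\in\mathcal{S}(\mathcal{H}_1)$ the class $\Lambda_{\mathcal{I}}[\rho]$ has a representative that is a positive operator at every $\omega\in\Omega$; and for every such representative $S$ and every fixed $\tilde\rho\in\mathcal{S}(\mathcal{H}_2)$ the function $$\pi_\rho(\omega)=\begin{cases}S(\omega)/\operatorname{Tr}\{S(\omega)\}&\text{if }\operatorname{Tr}\{S(\omega)\}>0,\\ \tilde\rho&\text{if }\operatorname{Tr}\{S(\omega)\}=0\end{cases}$$ is a family of a posteriori states for $(\rho,\mathcal{I})$. -/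

import Mathlib

open MeasureTheory ContinuousLinearMap Filter Topology
open scoped ENNReal ComplexOrder InnerProductSpace

noncomputable section

section TraceClassOperators

variable {H : Type*} [NormedAddCommGroup H] [InnerProductSpace ℂ H]

/-- The trace norm of a bounded operator with values in `[0, ∞]`: the supremum of
`∑ i, |⟪e i, T (f i)⟫|` over all finite orthonormal systems `e`, `f` of the same length.
It is equal to `Tr |T|`. -/
def traceENorm (T : H →L[ℂ] H) : ℝ≥0∞ :=
  ⨆ (n : ℕ) (e : Fin n → H) (f : Fin n → H) (_ : Orthonormal ℂ e) (_ : Orthonormal ℂ f),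
    ∑ i, ‖⟪e i, T (f i)⟫_ℂ‖ₑ

theorem le_traceENorm (T : H →L[ℂ] H) {n : ℕ} {e f : Fin n → H}
    (he : Orthonormal ℂ e) (hf : Orthonormal ℂ f) :
    ∑ i, ‖⟪e i, T (f i)⟫_ℂ‖ₑ ≤ traceENorm T := by
  unfold traceENorm
  exact le_iSup_of_le n (le_iSup_of_le e (le_iSup_of_le f (le_iSup_of_le he
    (le_iSup_of_le hf le_rfl))))

theorem traceENorm_le {T : H →L[ℂ] H} {C : ℝ≥0∞}
    (h : ∀ (n : ℕ) (e f : Fin n → H), Orthonormal ℂ e → Orthonormal ℂ f →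
      ∑ i, ‖⟪e i, T (f i)⟫_ℂ‖ₑ ≤ C) : traceENorm T ≤ C := by
  unfold traceENorm
  exact iSup_le fun n => iSup_le fun e => iSup_le fun f => iSup_le fun he => iSup_le fun hf =>
    h n e f he hf

theorem traceENorm_zero : traceENorm (0 : H →L[ℂ] H) = 0 :=
  le_antisymm (traceENorm_le (by simp)) bot_le

theorem traceENorm_add_le (S T : H →L[ℂ] H) :
    traceENorm (S + T) ≤ traceENorm S + traceENorm T := by
  refine traceENorm_le fun n e f he hf => ?_
  calc ∑ i, ‖⟪e i, (S + T) (f i)⟫_ℂ‖ₑ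
      ≤ ∑ i, (‖⟪e i, S (f i)⟫_ℂ‖ₑ + ‖⟪e i, T (f i)⟫_ℂ‖ₑ) := by
        refine Finset.sum_le_sum fun i _ => ?_
        rw [add_apply, inner_add_right]
        exact enorm_add_le _ _
    _ = ∑ i, ‖⟪e i, S (f i)⟫_ℂ‖ₑ + ∑ i, ‖⟪e i, T (f i)⟫_ℂ‖ₑ := Finset.sum_add_distrib
    _ ≤ traceENorm S + traceENorm T :=
        add_le_add (le_traceENorm S he hf) (le_traceENorm T he hf)

theorem traceENorm_smul_le (c : ℂ) (T : H →L[ℂ] H) :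
    traceENorm (c • T) ≤ ‖c‖ₑ * traceENorm T := by
  refine traceENorm_le fun n e f he hf => ?_
  calc ∑ i, ‖⟪e i, (c • T) (f i)⟫_ℂ‖ₑ = ‖c‖ₑ * ∑ i, ‖⟪e i, T (f i)⟫_ℂ‖ₑ := by
        rw [Finset.mul_sum]
        refine Finset.sum_congr rfl fun i _ => ?_
        rw [smul_apply, inner_smul_right, enorm_mul]
    _ ≤ ‖c‖ₑ * traceENorm T := by gcongr; exact le_traceENorm T he hf

theorem enorm_le_traceENorm (T : H →L[ℂ] H) : ‖T‖ₑ ≤ traceENorm T := by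
  by_cases hT : traceENorm T = ⊤
  · simp [hT]
  have key : ∀ x y : H, ‖x‖ = 1 → ‖y‖ = 1 → ‖⟪x, T y⟫_ℂ‖ ≤ (traceENorm T).toReal := by
    intro x y hx hy
    have h := le_traceENorm T (n := 1) (e := fun _ => x) (f := fun _ => y)
      ⟨fun _ => hx, fun i j hij => absurd (Subsingleton.elim i j) hij⟩
      ⟨fun _ => hy, fun i j hij => absurd (Subsingleton.elim i j) hij⟩
    simp only [Finset.univ_unique, Finset.sum_const, Finset.card_singleton, one_smul] at h
    have := ENNReal.toReal_mono hT h
    simpa using this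
  have hn : ‖T‖ ≤ (traceENorm T).toReal := by
    refine opNorm_le_of_unit_norm ENNReal.toReal_nonneg fun y hy => ?_
    by_cases h0 : T y = 0
    · simp [h0]
    have h1 : ‖T y‖ ≠ 0 := norm_ne_zero_iff.mpr h0
    have h2 := key (((‖T y‖⁻¹ : ℝ) : ℂ) • T y) y
      (by rw [norm_smul]; simp [h1]) hy
    rw [inner_smul_left, inner_self_eq_norm_sq_to_K, norm_mul] at h2
    have h3 : ‖(starRingEnd ℂ) ((‖T y‖⁻¹ : ℝ) : ℂ)‖ * ‖((‖T y‖ : ℝ) : ℂ) ^ 2‖ = ‖T y‖ := by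
      simp only [RCLike.norm_conj, Complex.norm_real, norm_pow, norm_inv, norm_norm]
      field_simp
    exact h3 ▸ h2
  rw [← ENNReal.ofReal_toReal hT, ← ofReal_norm]
  exact ENNReal.ofReal_le_ofReal hn

variable (H) in
/-- The subspace of trace-class operators. -/
def traceClassSubmodule : Submodule ℂ (H →L[ℂ] H) where
  carrier := {T | traceENorm T ≠ ⊤}
  zero_mem' := by simp [traceENorm_zero]
  add_mem' {S T} hS hT :=
    ne_top_of_le_ne_top (ENNReal.add_ne_top.mpr ⟨hS, hT⟩) (traceENorm_add_le S T)
  smul_mem' c T hT :=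
    ne_top_of_le_ne_top (ENNReal.mul_ne_top enorm_ne_top hT) (traceENorm_smul_le c T)

variable (H) in
/-- The space `𝒯(H)` of trace-class operators; it is normed by the trace norm below (not by the
operator norm). -/
def TraceClass : Type _ := traceClassSubmodule H

namespace TraceClass

instance : AddCommGroup (TraceClass H) := inferInstanceAs (AddCommGroup (traceClassSubmodule H))

instance : Module ℂ (TraceClass H) := inferInstanceAs (Module ℂ (traceClassSubmodule H))

variable (H) in
/-- A trace-class operator as a bounded operator. -/
def toCLM : TraceClass H →ₗ[ℂ] (H →L[ℂ] H) := (traceClassSubmodule H).subtype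

/-- A bounded operator of finite trace norm as a trace-class operator. -/
def ofCLM (T : H →L[ℂ] H) (hT : traceENorm T ≠ ⊤) : TraceClass H := ⟨T, hT⟩

theorem toCLM_ofCLM (T : H →L[ℂ] H) (hT : traceENorm T ≠ ⊤) : toCLM H (ofCLM T hT) = T := rfl

theorem toCLM_injective : Function.Injective (toCLM H) := Subtype.val_injective

theorem traceENorm_ne_top (T : TraceClass H) : traceENorm (toCLM H T) ≠ ⊤ := T.2

instance : Norm (TraceClass H) := ⟨fun T => (traceENorm (toCLM H T)).toReal⟩

theorem norm_def (T : TraceClass H) : ‖T‖ = (traceENorm (toCLM H T)).toReal := rfl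

theorem normCore : NormedSpace.Core ℂ (TraceClass H) where
  norm_nonneg T := ENNReal.toReal_nonneg
  norm_smul c T := by
    have hle : ∀ (c : ℂ) (T : TraceClass H), ‖c • T‖ ≤ ‖c‖ * ‖T‖ := by
      intro c T
      rw [norm_def, norm_def, map_smul, ← toReal_enorm c, ← ENNReal.toReal_mul]
      exact ENNReal.toReal_mono (ENNReal.mul_ne_top enorm_ne_top T.traceENorm_ne_top)
        (traceENorm_smul_le c _)
    refine le_antisymm (hle c T) ?_
    by_cases hc : c = 0
    · rw [hc, norm_zero, zero_mul]
      exact ENNReal.toReal_nonneg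
    have h := hle c⁻¹ (c • T)
    rw [inv_smul_smul₀ hc, norm_inv] at h
    have hc' : 0 < ‖c‖ := norm_pos_iff.mpr hc
    calc ‖c‖ * ‖T‖ ≤ ‖c‖ * (‖c‖⁻¹ * ‖c • T‖) := by gcongr
      _ = ‖c • T‖ := by field_simp
  norm_triangle S T := by
    rw [norm_def, norm_def, norm_def, map_add,
      ← ENNReal.toReal_add S.traceENorm_ne_top T.traceENorm_ne_top]
    exact ENNReal.toReal_mono
      (ENNReal.add_ne_top.mpr ⟨S.traceENorm_ne_top, T.traceENorm_ne_top⟩)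
      (traceENorm_add_le _ _)
  norm_eq_zero_iff T := by
    constructor
    · intro h
      rw [norm_def, ENNReal.toReal_eq_zero_iff] at h
      have h0 := h.resolve_right T.traceENorm_ne_top
      have h1 := enorm_le_traceENorm (toCLM H T)
      rw [h0, nonpos_iff_eq_zero, ← ofReal_norm, ENNReal.ofReal_eq_zero] at h1
      exact toCLM_injective (by rw [norm_le_zero_iff.mp h1, map_zero])
    · rintro rfl
      rw [norm_def, map_zero, traceENorm_zero, ENNReal.toReal_zero]

instance : NormedAddCommGroup (TraceClass H) := NormedAddCommGroup.ofCore normCore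

instance : NormedSpace ℂ (TraceClass H) := NormedSpace.ofCore normCore

theorem norm_toCLM_le (T : TraceClass H) : ‖toCLM H T‖ ≤ ‖T‖ := by
  rw [norm_def, ← toReal_enorm]
  exact ENNReal.toReal_mono T.traceENorm_ne_top (enorm_le_traceENorm _)

instance [CompleteSpace H] : CompleteSpace (TraceClass H) := by
  refine Metric.complete_of_cauchySeq_tendsto fun u hu => ?_
  have hv : CauchySeq fun n => toCLM H (u n) := by
    rw [Metric.cauchySeq_iff] at hu ⊢
    intro ε hε
    obtain ⟨N, hN⟩ := hu ε hε
    refine ⟨N, fun m hm n hn => lt_of_le_of_lt ?_ (hN m hm n hn)⟩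
    rw [dist_eq_norm, dist_eq_norm, ← map_sub]
    exact norm_toCLM_le _
  obtain ⟨T, hT⟩ := cauchySeq_tendsto_of_complete hv
  have key : ∀ ε : ℝ, 0 < ε → ∃ N, ∀ n ≥ N,
      traceENorm (toCLM H (u n) - T) ≤ ENNReal.ofReal ε := by
    intro ε hε
    obtain ⟨N, hN⟩ := Metric.cauchySeq_iff.mp hu ε hε
    refine ⟨N, fun n hn => traceENorm_le fun k e f he hf => ?_⟩
    have hlim : Tendsto (fun m => ∑ i, ‖⟪e i, (toCLM H (u n) - toCLM H (u m)) (f i)⟫_ℂ‖ₑ) atTop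
        (𝓝 (∑ i, ‖⟪e i, (toCLM H (u n) - T) (f i)⟫_ℂ‖ₑ)) := by
      refine tendsto_finsetSum _ fun i _ => ?_
      have h1 : Tendsto (fun m => (toCLM H (u n) - toCLM H (u m)) (f i)) atTop
          (𝓝 ((toCLM H (u n) - T) (f i))) :=
        ((ContinuousLinearMap.apply ℂ H (f i)).continuous.tendsto _).comp
          (tendsto_const_nhds.sub hT)
      exact (tendsto_const_nhds.inner h1).enorm
    refine le_of_tendsto hlim ((eventually_ge_atTop N).mono fun m hm => ?_)
    refine (le_traceENorm _ he hf).trans ?_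
    have h2 := hN n hn m hm
    rw [dist_eq_norm, norm_def, map_sub] at h2
    rw [← map_sub, ← ENNReal.ofReal_toReal (u n - u m).traceENorm_ne_top, map_sub]
    exact ENNReal.ofReal_le_ofReal h2.le
  obtain ⟨N, hN⟩ := key 1 one_pos
  have hTmem : traceENorm T ≠ ⊤ := by
    have h1 : toCLM H (u N) - T ∈ traceClassSubmodule H :=
      ne_top_of_le_ne_top ENNReal.ofReal_ne_top (hN N le_rfl)
    have h2 := (traceClassSubmodule H).sub_mem (u N).2 h1
    have h3 : (u N).1 - (toCLM H (u N) - T) = T := sub_sub_cancel _ _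
    rw [h3] at h2
    exact h2
  refine ⟨ofCLM T hTmem, Metric.tendsto_atTop.mpr fun ε hε => ?_⟩
  obtain ⟨M, hM⟩ := key (ε / 2) (by positivity)
  refine ⟨M, fun n hn => ?_⟩
  rw [dist_eq_norm, norm_def, map_sub, toCLM_ofCLM]
  have h4 := ENNReal.toReal_mono ENNReal.ofReal_ne_top (hM n hn)
  rw [ENNReal.toReal_ofReal (by positivity)] at h4
  linarith

/-- Positivity of a trace-class operator. -/
def IsPositive (T : TraceClass H) : Prop := (toCLM H T).IsPositive

/-- Positivity of an element `(T i j)` of `M_n(𝒯(H))`, i.e. of the corresponding block operator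
on the `n`-fold direct sum of `H` with itself. -/
def IsPositiveBlock {n : ℕ} (T : Fin n → Fin n → TraceClass H) : Prop :=
  ∀ v : Fin n → H, 0 ≤ ∑ i, ∑ j, ⟪v i, toCLM H (T i j) (v j)⟫_ℂ

theorem IsPositiveBlock.isPositive {T : Fin 1 → Fin 1 → TraceClass H}
    (hT : IsPositiveBlock T) : (T 0 0).IsPositive := by
  rw [TraceClass.IsPositive, ContinuousLinearMap.isPositive_iff_complex]
  intro x
  have h := hT fun _ => x
  simp only [Finset.univ_unique, Finset.sum_singleton, Fin.default_eq_zero] at h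
  have h2 := Complex.nonneg_iff.mp h
  rw [← inner_conj_symm]
  refine ⟨Complex.ext ?_ ?_, ?_⟩
  · simp
  · rw [Complex.conj_im, ← h2.2]
    simp
  · exact h2.1

theorem IsPositive.isPositiveBlock {T : TraceClass H} (hT : T.IsPositive) :
    IsPositiveBlock (n := 1) fun _ _ => T := by
  intro v
  simpa using ContinuousLinearMap.IsPositive.inner_nonneg_right hT (v 0)

end TraceClass

variable [CompleteSpace H]

variable (H) in
/-- The index set of a fixed orthonormal basis of `H`. -/
def basisIndex : Set H := (exists_hilbertBasis ℂ H).choose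

variable (H) in
/-- A fixed orthonormal basis of `H`. -/
def hilbertBasis : HilbertBasis (basisIndex H) ℂ H :=
  (exists_hilbertBasis ℂ H).choose_spec.choose

/-- `Tr T = ∑ i, ⟪b i, T (b i)⟫` over an orthonormal basis `b` of `H`. For trace-class `T` the
series converges absolutely and its sum does not depend on the basis, so one basis is fixed. -/
def opTrace (T : H →L[ℂ] H) : ℂ :=
  ∑' i, ⟪hilbertBasis H i, T (hilbertBasis H i)⟫_ℂ

theorem opTrace_smul (c : ℂ) (T : H →L[ℂ] H) : opTrace (c • T) = c * opTrace T := by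
  simp only [opTrace, smul_apply, inner_smul_right, tsum_mul_left]

theorem opTrace_re_nonneg {T : H →L[ℂ] H} (hT : T.IsPositive) : 0 ≤ (opTrace T).re := by
  unfold opTrace
  by_cases hs : Summable fun i => ⟪hilbertBasis H i, T (hilbertBasis H i)⟫_ℂ
  · rw [Complex.re_tsum hs]
    exact tsum_nonneg fun i => hT.re_inner_nonneg_right _
  · simp [tsum_eq_zero_of_not_summable hs]

theorem opTrace_eq_re {T : H →L[ℂ] H} (hT : T.IsPositive) :
    opTrace T = ((opTrace T).re : ℂ) := by
  have h : ∀ x : H, ⟪x, T x⟫_ℂ = ((⟪x, T x⟫_ℂ).re : ℂ) := fun x =>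
    Complex.ext rfl (by
      simpa using (Complex.nonneg_iff.mp (hT.inner_nonneg_right x)).2.symm)
  unfold opTrace
  by_cases hs : Summable fun i => ⟪hilbertBasis H i, T (hilbertBasis H i)⟫_ℂ
  · rw [Complex.re_tsum hs, Complex.ofReal_tsum]
    exact tsum_congr fun i => h _
  · simp [tsum_eq_zero_of_not_summable hs]

namespace TraceClass

/-- The trace of a trace-class operator. -/
def trace (T : TraceClass H) : ℂ := opTrace (toCLM H T)

/-- The duality `⟨T, a⟩ = Tr (T a)` between trace-class and bounded operators. -/
def pairing (T : TraceClass H) (a : H →L[ℂ] H) : ℂ := opTrace (toCLM H T ∘L a)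

end TraceClass

variable (H) in
/-- The set `𝒮(H)` of statistical (density) operators: positive trace-class operators of
trace one. -/
def DensityOperator : Type _ := {T : TraceClass H // T.IsPositive ∧ T.trace = 1}

/-- A density operator as a trace-class operator. -/
def DensityOperator.toTraceClass (ρ : DensityOperator H) : TraceClass H := ρ.1

/-- The normalization `T / Tr T` of a positive trace-class operator if `Tr T > 0`, and the given
density operator `τ` if `Tr T = 0`. -/
def DensityOperator.normalize (τ : DensityOperator H) (T : TraceClass H) (hT : T.IsPositive) :
    DensityOperator H :=
  if h : 0 < T.trace.re then
    ⟨(T.trace)⁻¹ • T, by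
      have hre : T.trace = (T.trace.re : ℂ) := opTrace_eq_re hT
      constructor
      · have h0 : (0 : ℂ) ≤ (T.trace)⁻¹ := by
          rw [hre, ← Complex.ofReal_inv, Complex.zero_le_real]
          exact inv_nonneg.mpr h.le
        rw [TraceClass.IsPositive, map_smul]
        exact ContinuousLinearMap.IsPositive.smul_of_nonneg hT h0
      · have hne : T.trace ≠ 0 := fun h1 => by rw [h1] at h; simp at h
        rw [TraceClass.trace, map_smul, opTrace_smul]
        exact inv_mul_cancel₀ hne⟩
  else τ

end TraceClassOperators

section Instruments

variable {H₁ : Type*} [NormedAddCommGroup H₁] [InnerProductSpace ℂ H₁] [CompleteSpace H₁]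
variable {H₂ : Type*} [NormedAddCommGroup H₂] [InnerProductSpace ℂ H₂] [CompleteSpace H₂]
variable {Ω : Type*} [MeasurableSpace Ω]

/-- Complete positivity of a linear map `𝒯(H₁) → 𝒯(H₂)`: all its entrywise extensions
`M_n(𝒯(H₁)) → M_n(𝒯(H₂))` preserve positivity. -/
def IsCompletelyPositive (Φ : TraceClass H₁ →L[ℂ] TraceClass H₂) : Prop :=
  ∀ (n : ℕ) (T : Fin n → Fin n → TraceClass H₁), TraceClass.IsPositiveBlock T →
    TraceClass.IsPositiveBlock fun i j => Φ (T i j)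

/-- Complete positivity of a linear map `𝒯(H₁) → L¹(Ω, Q; 𝒯(H₂))`, where an element of
`M_n(L¹(Ω, Q; 𝒯(H₂)))` is positive if its value at `Q`-almost every point is. -/
def IsCompletelyPositiveL1 {Q : Measure Ω}
    (Λ : TraceClass H₁ →L[ℂ] Lp (TraceClass H₂) 1 Q) : Prop :=
  ∀ (n : ℕ) (T : Fin n → Fin n → TraceClass H₁), TraceClass.IsPositiveBlock T →
    ∀ᵐ ω ∂Q, TraceClass.IsPositiveBlock fun i j => Λ (T i j) ω

variable (H₁ H₂ Ω) in
/-- An instrument on the measurable space `Ω`. Only its values on measurable sets matter. -/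
structure Instrument where
  toFun : Set Ω → (TraceClass H₁ →L[ℂ] TraceClass H₂)
  completelyPositive : ∀ F, MeasurableSet F → IsCompletelyPositive (toFun F)
  normalized : ∀ ρ : TraceClass H₁, (toFun Set.univ ρ).trace = ρ.trace
  sigmaAdditive : ∀ F : ℕ → Set Ω, (∀ i, MeasurableSet (F i)) →
    Pairwise (Function.onFun Disjoint F) → ∀ (ρ : TraceClass H₁) (a : H₂ →L[ℂ] H₂),
      HasSum (fun i => (toFun (F i) ρ).pairing a) ((toFun (⋃ i, F i) ρ).pairing a)

namespace Instrument

variable (I : Instrument H₁ H₂ Ω)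

theorem pairing_empty (ρ : TraceClass H₁) (a : H₂ →L[ℂ] H₂) :
    (I.toFun ∅ ρ).pairing a = 0 := by
  have h := I.sigmaAdditive (fun _ => ∅) (fun _ => MeasurableSet.empty)
    (fun _ _ _ => disjoint_bot_left) ρ a
  exact (summable_const_iff _).mp h.summable

theorem pairing_one (T : TraceClass H₂) : T.pairing 1 = T.trace := rfl

theorem isPositive_apply {F : Set Ω} (hF : MeasurableSet F) {ρ : TraceClass H₁}
    (hρ : ρ.IsPositive) : (I.toFun F ρ).IsPositive :=
  (I.completelyPositive F hF 1 (fun _ _ => ρ) hρ.isPositiveBlock).isPositive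

open Classical in
/-- The complex measure `F ↦ ⟨I(F)[ρ], a⟩`. -/
def pairingMeasure (ρ : TraceClass H₁) (a : H₂ →L[ℂ] H₂) : ComplexMeasure Ω where
  measureOf' F := if MeasurableSet F then (I.toFun F ρ).pairing a else 0
  empty' := by simp [pairing_empty]
  not_measurable' F hF := if_neg hF
  m_iUnion' F hF hd := by
    simp only [hF, MeasurableSet.iUnion hF, if_true]
    exact I.sigmaAdditive F hF hd ρ a

/-- The probability measure `P_ρ(F) = Tr (I(F)[ρ])` of the outcomes in the input state `ρ`. -/
def prob (ρ : DensityOperator H₁) : Measure Ω :=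
  Measure.ofMeasurable (fun F _ => ENNReal.ofReal (I.toFun F ρ.toTraceClass).trace.re)
    (by rw [← pairing_one, pairing_empty]; simp)
    (by
      intro F hF hd
      have h := Complex.hasSum_re (I.sigmaAdditive F hF hd ρ.toTraceClass 1)
      simp only [pairing_one] at h
      rw [← h.tsum_eq]
      exact ENNReal.ofReal_tsum_of_nonneg
        (fun i => opTrace_re_nonneg (I.isPositive_apply (hF i) ρ.2.1)) h.summable)

theorem prob_apply (ρ : DensityOperator H₁) {F : Set Ω} (hF : MeasurableSet F) :
    I.prob ρ F = ENNReal.ofReal (I.toFun F ρ.toTraceClass).trace.re :=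
  Measure.ofMeasurable_apply F hF

/-- `π` is a family of a posteriori states for `(ρ, I)`: it is measurable and
`∫_F π(ω) P_ρ(dω) = I(F)[ρ]` (Bochner integral in `𝒯(H₂)`) for all measurable `F`. For separable
`H₂` the space `𝒯(H₂)` is separable, and strong measurability is Borel measurability. -/
structure IsAPosteriori (ρ : DensityOperator H₁) (π : Ω → DensityOperator H₂) : Prop where
  stronglyMeasurable : StronglyMeasurable fun ω => (π ω).toTraceClass
  integrable : Integrable (fun ω => (π ω).toTraceClass) (I.prob ρ)
  setIntegral_eq : ∀ F, MeasurableSet F →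
    ∫ ω in F, (π ω).toTraceClass ∂(I.prob ρ) = I.toFun F ρ.toTraceClass

/-- `Λ` is the preadjoint of the channel `Λ_I^* : L^∞(Ω, Q; ℒ(H₂)) → ℒ(H₁)` of the instrument:
it is completely positive and normalized (a channel), and
`⟨ρ, Λ_I^*[a ⊗ f]⟩ = ⟨Λ[ρ], a ⊗ f⟩ = ∫ f(ω) ⟨Λ[ρ](ω), a⟩ Q(dω)` is equal to
`∫ f(ω) ⟨I(dω)[ρ], a⟩` for all `ρ`, all `a ∈ ℒ(H₂)` and all `f ∈ L^∞(Ω, Q)`. -/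
structure IsPreadjointChannel (Q : Measure Ω)
    (Λ : TraceClass H₁ →L[ℂ] Lp (TraceClass H₂) 1 Q) : Prop where
  completelyPositive : IsCompletelyPositiveL1 Λ
  normalized : ∀ ρ : TraceClass H₁, ∫ ω, (Λ ρ ω).trace ∂Q = ρ.trace
  pairing_eq : ∀ (ρ : TraceClass H₁) (a : H₂ →L[ℂ] H₂) (f : Lp ℂ ∞ Q),
    ∫ ω, f ω * (Λ ρ ω).pairing a ∂Q =
      (I.pairingMeasure ρ a).integral f (ContinuousLinearMap.mul ℝ ℂ)

end Instrument

end Instruments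

end

/-! For positive `ρ`, `F ↦ I(F)[ρ]` is a positive trace-class valued measure. Since a positive
operator of trace zero is zero, `P_ρ ≪ Q` makes it vanish on `Q`-null sets. The core is a
Radon-Nikodym theorem for such measures, `exists_density_of_isPositive`. In a fixed orthonormal
basis each matrix entry is a complex measure with a scalar density. Truncating the matrix of
densities to a finite index set `s` gives integrable functions `G s` whose set integrals are
compressions of `I(F)[ρ]`. They are positive almost everywhere, and the trace-norm distance of a
positive operator from its compression is controlled by the two traces
(`IsPositive.norm_sub_compress_le`). Integrating this estimate shows that `G` is Cauchy in L¹; its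
limit is the density.

The trace-norm bounds come from factorizations `A = X* X` and Hilbert-Schmidt sums. Their constants
are not sharp, since only finiteness and continuity matter. Every trace-class operator combines four
positive ones with norm control, so existence and boundedness pass to all `ρ`.

Uniqueness of densities makes the density linear in `ρ`, which gives `Λ`. Conversely, testing the
duality on indicators and rank-one operators shows that every preadjoint channel consists of
densities, hence equals `Λ`. Finally, for a positive representative `S`, the measure `P_ρ` has
`Q`-density `Tr S`, and `(Tr S) π = S` pointwise, so integrating `π` against `P_ρ` over `F` gives
`I(F)[ρ]`. -/

noncomputable section

/-! ### Hilbert-Schmidt sums and trace-norm bounds -/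

section HilbertSchmidt

variable {H : Type*} [NormedAddCommGroup H] [InnerProductSpace ℂ H]

/-- Parseval's identity with values in `[0, ∞]`. -/
theorem HilbertBasis.tsum_enorm_inner_sq {ι : Type*} (c : HilbertBasis ι ℂ H) (x : H) :
    ∑' i, ‖⟪c i, x⟫_ℂ‖ₑ ^ 2 = ‖x‖ₑ ^ 2 := by
  have h := Complex.hasSum_re (c.hasSum_inner_mul_inner x x)
  have h1 : ∀ i, (⟪x, c i⟫_ℂ * ⟪c i, x⟫_ℂ).re = ‖⟪c i, x⟫_ℂ‖ ^ 2 := fun i => by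
    rw [← inner_conj_symm x (c i), ← Complex.normSq_eq_conj_mul_self, Complex.ofReal_re,
      Complex.normSq_eq_norm_sq]
  have h2 : (⟪x, x⟫_ℂ).re = ‖x‖ ^ 2 := inner_self_eq_norm_sq (𝕜 := ℂ) x
  simp only [h1, h2] at h
  have h3 : ∀ y : ℂ, ‖y‖ₑ ^ 2 = ENNReal.ofReal (‖y‖ ^ 2) := fun y => by
    rw [← ofReal_norm, ENNReal.ofReal_pow (norm_nonneg _)]
  simp only [h3]
  rw [← ENNReal.ofReal_tsum_of_nonneg (fun i => by positivity) h.summable, h.tsum_eq,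
    ← ofReal_norm, ENNReal.ofReal_pow (norm_nonneg _)]

/-- Bessel's inequality with values in `[0, ∞]`. -/
theorem Orthonormal.sum_enorm_inner_sq_le {n : ℕ} {e : Fin n → H} (he : Orthonormal ℂ e) (x : H) :
    ∑ i, ‖⟪e i, x⟫_ℂ‖ₑ ^ 2 ≤ ‖x‖ₑ ^ 2 := by
  have h := he.sum_inner_products_le (s := Finset.univ) x
  have h3 : ∀ y : ℂ, ‖y‖ₑ ^ 2 = ENNReal.ofReal (‖y‖ ^ 2) := fun y => by
    rw [← ofReal_norm, ENNReal.ofReal_pow (norm_nonneg _)]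
  simp only [h3]
  rw [← ENNReal.ofReal_sum_of_nonneg (fun i _ => by positivity), ← ofReal_norm,
    ← ENNReal.ofReal_pow (norm_nonneg _)]
  exact ENNReal.ofReal_le_ofReal h

theorem enorm_inner_symm (x y : H) : ‖⟪x, y⟫_ℂ‖ₑ = ‖⟪y, x⟫_ℂ‖ₑ := by
  rw [← ofReal_norm, norm_inner_symm, ofReal_norm]

theorem enorm_inner_le_sq_add_sq (x y : H) : ‖⟪x, y⟫_ℂ‖ₑ ≤ ‖x‖ₑ ^ 2 + ‖y‖ₑ ^ 2 := by
  have h : ‖⟪x, y⟫_ℂ‖ ≤ ‖x‖ ^ 2 + ‖y‖ ^ 2 := by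
    nlinarith [norm_inner_le_norm (𝕜 := ℂ) x y, sq_nonneg (‖x‖ - ‖y‖), sq_nonneg (‖x‖ + ‖y‖)]
  rw [← ofReal_norm, ← ofReal_norm, ← ofReal_norm, ← ENNReal.ofReal_pow (norm_nonneg _),
    ← ENNReal.ofReal_pow (norm_nonneg _), ← ENNReal.ofReal_add (by positivity) (by positivity)]
  exact ENNReal.ofReal_le_ofReal h

variable [CompleteSpace H]

/-- The square of the Hilbert-Schmidt norm, with values in `[0, ∞]`. -/
def hsSum (X : H →L[ℂ] H) : ℝ≥0∞ := ∑' k, ‖X (hilbertBasis H k)‖ₑ ^ 2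

/-- By Parseval both sides are the same double sum of squared matrix entries, in the two orders of
summation. -/
theorem hsSum_adjoint (X : H →L[ℂ] H) : hsSum (adjoint X) = hsSum X := by
  unfold hsSum
  simp only [← (hilbertBasis H).tsum_enorm_inner_sq]
  rw [ENNReal.tsum_comm]
  refine tsum_congr fun i => tsum_congr fun j => ?_
  rw [adjoint_inner_right, enorm_inner_symm]

/-- Parseval and passage to the adjoint turn the left side into a sum over the basis of Bessel sums
for the vectors `X* b k`. -/
theorem Orthonormal.sum_enorm_sq_le_hsSum {n : ℕ} {e : Fin n → H} (he : Orthonormal ℂ e)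
    (X : H →L[ℂ] H) : ∑ i, ‖X (e i)‖ₑ ^ 2 ≤ hsSum X := by
  rw [← hsSum_adjoint]
  calc ∑ i, ‖X (e i)‖ₑ ^ 2
      = ∑' k, ∑ i, ‖⟪e i, adjoint X (hilbertBasis H k)⟫_ℂ‖ₑ ^ 2 := by
        simp only [← (hilbertBasis H).tsum_enorm_inner_sq (X _)]
        rw [Summable.tsum_finsetSum fun _ _ => ENNReal.summable]
        refine Finset.sum_congr rfl fun i _ => tsum_congr fun k => ?_
        rw [adjoint_inner_right, enorm_inner_symm]
    _ ≤ hsSum (adjoint X) := ENNReal.tsum_le_tsum fun k => he.sum_enorm_inner_sq_le _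

theorem hsSum_comp_le_left (C X : H →L[ℂ] H) : hsSum (C ∘L X) ≤ ‖C‖ₑ ^ 2 * hsSum X := by
  unfold hsSum
  rw [← ENNReal.tsum_mul_left]
  refine ENNReal.tsum_le_tsum fun k => ?_
  rw [← mul_pow]
  gcongr
  exact C.le_opENorm _

theorem hsSum_comp_le_right (X C : H →L[ℂ] H) : hsSum (X ∘L C) ≤ ‖C‖ₑ ^ 2 * hsSum X := by
  rw [← hsSum_adjoint, adjoint_comp, ← hsSum_adjoint X]
  refine (hsSum_comp_le_left _ _).trans_eq ?_
  rw [← ofReal_norm, LinearIsometryEquiv.norm_map, ofReal_norm]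

theorem hsSum_smul (c : ℂ) (X : H →L[ℂ] H) : hsSum (c • X) = ‖c‖ₑ ^ 2 * hsSum X := by
  unfold hsSum
  rw [← ENNReal.tsum_mul_left]
  exact tsum_congr fun k => by rw [smul_apply, enorm_smul, mul_pow]

/-- Since `⟪e, X* Y f⟫ = ⟪X e, Y f⟫`, Cauchy-Schwarz and AM-GM reduce the claim to Hilbert-Schmidt
sums over orthonormal systems. -/
theorem traceENorm_adjoint_comp_le (X Y : H →L[ℂ] H) :
    traceENorm (adjoint X ∘L Y) ≤ hsSum X + hsSum Y := by
  refine traceENorm_le fun n e f he hf => ?_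
  calc ∑ i, ‖⟪e i, (adjoint X ∘L Y) (f i)⟫_ℂ‖ₑ
      ≤ ∑ i, (‖X (e i)‖ₑ ^ 2 + ‖Y (f i)‖ₑ ^ 2) := Finset.sum_le_sum fun i _ => by
        rw [comp_apply, adjoint_inner_right]
        exact enorm_inner_le_sq_add_sq _ _
    _ ≤ hsSum X + hsSum Y := by
        rw [Finset.sum_add_distrib]
        exact add_le_add (he.sum_enorm_sq_le_hsSum X) (hf.sum_enorm_sq_le_hsSum Y)

/-- The sum of the absolute values of the diagonal entries of an operator. -/
def diagSum (T : H →L[ℂ] H) : ℝ≥0∞ := ∑' k, ‖⟪hilbertBasis H k, T (hilbertBasis H k)⟫_ℂ‖ₑ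

omit [CompleteSpace H] in
theorem Orthonormal.tsum_enorm_le_traceENorm {ι : Type*} {e : ι → H} (he : Orthonormal ℂ e)
    (T : H →L[ℂ] H) : ∑' k, ‖⟪e k, T (e k)⟫_ℂ‖ₑ ≤ traceENorm T := by
  rw [ENNReal.tsum_eq_iSup_sum]
  refine iSup_le fun s => ?_
  have h := le_traceENorm T (he.comp _ (Subtype.val_injective.comp s.equivFin.symm.injective))
    (he.comp _ (Subtype.val_injective.comp s.equivFin.symm.injective))
  refine le_trans (le_of_eq ?_) h
  rw [← Finset.sum_coe_sort]
  exact (Equiv.sum_comp s.equivFin.symm fun k : s => ‖⟪e k, T (e k)⟫_ℂ‖ₑ).symm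

theorem diagSum_le_traceENorm (T : H →L[ℂ] H) : diagSum T ≤ traceENorm T :=
  (hilbertBasis H).orthonormal.tsum_enorm_le_traceENorm T

omit [CompleteSpace H] in
theorem traceENorm_neg (T : H →L[ℂ] H) : traceENorm (-T) = traceENorm T := by
  unfold traceENorm
  simp

theorem traceENorm_adjoint (T : H →L[ℂ] H) : traceENorm (adjoint T) = traceENorm T := by
  have h : ∀ T : H →L[ℂ] H, traceENorm (adjoint T) ≤ traceENorm T := fun T =>
    traceENorm_le fun n e f he hf => by
      refine le_trans (le_of_eq ?_) (le_traceENorm T hf he)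
      exact Finset.sum_congr rfl fun i _ => by rw [adjoint_inner_right, enorm_inner_symm]
  refine le_antisymm (h T) ?_
  conv_lhs => rw [← adjoint_adjoint T]
  exact h _

/-- The square root of a positive operator, as a factorization. -/
theorem ContinuousLinearMap.IsPositive.exists_adjoint_comp {A : H →L[ℂ] H} (hA : A.IsPositive) :
    ∃ X : H →L[ℂ] H, IsSelfAdjoint X ∧ adjoint X ∘L X = A := by
  have h0 : 0 ≤ A := (nonneg_iff_isPositive A).mpr hA
  have h1 : IsSelfAdjoint (CFC.sqrt A) := IsSelfAdjoint.of_nonneg (CFC.sqrt_nonneg A)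
  refine ⟨CFC.sqrt A, h1, ?_⟩
  rw [isSelfAdjoint_iff'.mp h1]
  exact CFC.sqrt_mul_sqrt_self A h0

theorem enorm_sq_eq_enorm_inner_adjoint_comp (X : H →L[ℂ] H) (x : H) :
    ‖X x‖ₑ ^ 2 = ‖⟪x, (adjoint X ∘L X) x⟫_ℂ‖ₑ := by
  rw [comp_apply, adjoint_inner_right, ← ofReal_norm, ← ENNReal.ofReal_pow (norm_nonneg _),
    ← ofReal_norm, inner_self_eq_norm_sq_to_K]
  simp

theorem hsSum_eq_diagSum (X : H →L[ℂ] H) : hsSum X = diagSum (adjoint X ∘L X) :=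
  tsum_congr fun _ => enorm_sq_eq_enorm_inner_adjoint_comp X _

/-- Write `A = X* X` and bracket `A C` as `X* (X C)`; the Hilbert-Schmidt sum of `X` is the diagonal
sum of `A`. -/
theorem traceENorm_comp_le_of_isPositive {A : H →L[ℂ] H} (hA : A.IsPositive) (C : H →L[ℂ] H) :
    traceENorm (A ∘L C) ≤ (1 + ‖C‖ₑ ^ 2) * diagSum A := by
  obtain ⟨X, -, rfl⟩ := hA.exists_adjoint_comp
  rw [← hsSum_eq_diagSum, add_mul, one_mul]
  exact (traceENorm_adjoint_comp_le X (X ∘L C)).trans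
    (add_le_add le_rfl (hsSum_comp_le_right _ _))

theorem traceENorm_le_of_isPositive {A : H →L[ℂ] H} (hA : A.IsPositive) :
    traceENorm A ≤ 2 * diagSum A := by
  obtain ⟨X, -, rfl⟩ := hA.exists_adjoint_comp
  rw [← hsSum_eq_diagSum, two_mul]
  exact traceENorm_adjoint_comp_le X X

/-- The positive part of a self-adjoint operator of finite trace norm has finite trace norm. -/
theorem traceENorm_posPart_le (A : H →L[ℂ] H) (hA : IsSelfAdjoint A) :
    traceENorm A⁺ ≤ 2 * traceENorm A := by
  have hp : (A⁺).IsPositive := (nonneg_iff_isPositive _).mp (CFC.posPart_nonneg A)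
  refine (traceENorm_le_of_isPositive hp).trans ?_
  gcongr
  obtain ⟨X, hX, hXA⟩ := hp.exists_adjoint_comp
  have hX' : adjoint X = X := isSelfAdjoint_iff'.mp hX
  have hneg : IsSelfAdjoint A⁻ := IsSelfAdjoint.of_nonneg (CFC.negPart_nonneg A)
  -- With `X² = A⁺` and `A⁺ A⁻ = 0`, the squared norm of `X (A⁻ y)` is `⟪A⁻ y, A⁺ A⁻ y⟫ = 0`.
  have hzero : ∀ y, X (A⁻ y) = 0 := fun y => by
    have h1 : A⁺ (A⁻ y) = 0 := by
      exact congrArg (fun T : H →L[ℂ] H => T (y)) (CFC.posPart_mul_negPart A)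
    have h2 := enorm_sq_eq_enorm_inner_adjoint_comp X (A⁻ y)
    rw [hXA, h1, inner_zero_right, enorm_zero] at h2
    simpa using h2
  have hzero' : ∀ y, A⁻ (X y) = 0 := fun y => by
    refine ext_inner_left ℂ fun v => ?_
    rw [inner_zero_right, ← isSelfAdjoint_iff'.mp hneg, adjoint_inner_right, ← hX',
      adjoint_inner_right, hzero, inner_zero_left]
  -- An orthonormal basis of the closed range of `X` computes the whole Hilbert-Schmidt sum of `X`.
  -- On it `A⁻` vanishes, so `A⁺` may be replaced by `A` in the diagonal entries.
  set M : Submodule ℂ H := (LinearMap.range (X : H →ₗ[ℂ] H)).topologicalClosure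
  have hM : ∀ y ∈ M, A⁻ y = 0 := fun y hy => by
    have hle : M ≤ LinearMap.ker ((A⁻ : H →L[ℂ] H) : H →ₗ[ℂ] H) := by
      refine Submodule.topologicalClosure_minimal _ ?_ (A⁻).isClosed_ker
      rintro _ ⟨z, rfl⟩
      exact hzero' z
    exact hle hy
  have hXM : ∀ y, X y ∈ M := fun y => Submodule.le_topologicalClosure _ ⟨y, rfl⟩
  have : CompleteSpace M := (Submodule.isClosed_topologicalClosure _).completeSpace_coe
  obtain ⟨w, c, -⟩ := exists_hilbertBasis ℂ M
  have hc : Orthonormal ℂ fun i => (c i : H) := c.orthonormal.comp_linearIsometry M.subtypeₗᵢ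
  calc diagSum A⁺ = hsSum X := by rw [hsSum_eq_diagSum, hXA]
    _ = ∑' k, ∑' i, ‖⟪(c i : H), X (hilbertBasis H k)⟫_ℂ‖ₑ ^ 2 := by
        refine tsum_congr fun k => ?_
        have h := c.tsum_enorm_inner_sq ⟨X (hilbertBasis H k), hXM _⟩
        exact h.symm
    _ = ∑' i, ‖X (c i)‖ₑ ^ 2 := by
        rw [ENNReal.tsum_comm]
        refine tsum_congr fun i => ?_
        rw [← (hilbertBasis H).tsum_enorm_inner_sq]
        refine tsum_congr fun k => ?_
        rw [enorm_inner_symm, ← adjoint_inner_right, hX']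
    _ = ∑' i, ‖⟪(c i : H), A (c i)⟫_ℂ‖ₑ := by
        refine tsum_congr fun i => ?_
        rw [enorm_sq_eq_enorm_inner_adjoint_comp, hXA]
        congr 2
        conv_rhs => rw [← CFC.posPart_sub_negPart A hA, sub_apply, hM _ (c i).2, sub_zero]
    _ ≤ traceENorm A := hc.tsum_enorm_le_traceENorm A

end HilbertSchmidt

/-! ### Positive decompositions, the trace pairing and rank-one operators -/

section TraceClassBounds

variable {H : Type*} [NormedAddCommGroup H] [InnerProductSpace ℂ H]

namespace TraceClass

variable (H) in
/-- The inclusion of the trace-class operators into the bounded operators, as a bounded map. -/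
def toCLML : TraceClass H →L[ℂ] (H →L[ℂ] H) :=
  (toCLM H).mkContinuous 1 fun T => by simpa using norm_toCLM_le T

/-- The matrix element `⟪x, T y⟫` as a bounded functional of the trace-class operator `T`. -/
def entry (x y : H) : TraceClass H →L[ℂ] ℂ :=
  (innerSL ℂ x) ∘L (ContinuousLinearMap.apply ℂ H y) ∘L toCLML H

theorem entry_apply (x y : H) (T : TraceClass H) : entry x y T = ⟪x, toCLM H T y⟫_ℂ := rfl

theorem ext_entry {S T : TraceClass H} (h : ∀ x y, entry x y S = entry x y T) : S = T :=
  toCLM_injective (ContinuousLinearMap.ext fun y => ext_inner_left ℂ fun x => h x y)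

theorem enorm_eq (T : TraceClass H) : ‖T‖ₑ = traceENorm (toCLM H T) := by
  rw [← ofReal_norm, norm_def, ENNReal.ofReal_toReal T.traceENorm_ne_top]

variable [CompleteSpace H]

/-- A trace-class self-adjoint operator is a difference of two positive ones. -/
theorem exists_isPositive_sub {T : TraceClass H} (hT : IsSelfAdjoint (toCLM H T)) :
    ∃ A B : TraceClass H, A.IsPositive ∧ B.IsPositive ∧ T = A - B ∧
      ‖A‖ₑ ≤ 2 * ‖T‖ₑ ∧ ‖B‖ₑ ≤ 2 * ‖T‖ₑ := by
  have h1 := traceENorm_posPart_le _ hT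
  have h2 := traceENorm_posPart_le _ hT.neg
  rw [CFC.posPart_neg, traceENorm_neg] at h2
  have hfin : 2 * traceENorm (toCLM H T) ≠ ⊤ :=
    ENNReal.mul_ne_top (by simp) T.traceENorm_ne_top
  refine ⟨ofCLM _ (ne_top_of_le_ne_top hfin h1), ofCLM _ (ne_top_of_le_ne_top hfin h2),
    (nonneg_iff_isPositive _).mp (CFC.posPart_nonneg _),
    (nonneg_iff_isPositive _).mp (CFC.negPart_nonneg _), toCLM_injective ?_, ?_, ?_⟩
  · rw [map_sub, toCLM_ofCLM, toCLM_ofCLM, CFC.posPart_sub_negPart _ hT]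
  · rw [enorm_eq, enorm_eq]; exact h1
  · rw [enorm_eq, enorm_eq]; exact h2

/-- The adjoint of a trace-class operator. -/
def adj (T : TraceClass H) : TraceClass H :=
  ofCLM (adjoint (toCLM H T)) (by rw [traceENorm_adjoint]; exact T.traceENorm_ne_top)

theorem toCLM_adj (T : TraceClass H) : toCLM H T.adj = adjoint (toCLM H T) := rfl

theorem enorm_adj (T : TraceClass H) : ‖T.adj‖ₑ = ‖T‖ₑ := by
  rw [enorm_eq, enorm_eq, toCLM_adj, traceENorm_adjoint]

theorem exists_selfAdjoint_add (T : TraceClass H) :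
    ∃ A B : TraceClass H, IsSelfAdjoint (toCLM H A) ∧ IsSelfAdjoint (toCLM H B) ∧
      T = A + Complex.I • B ∧ ‖A‖ₑ ≤ ‖T‖ₑ ∧ ‖B‖ₑ ≤ ‖T‖ₑ := by
  have hbound : ∀ (c : ℂ) (S : TraceClass H), ‖c‖ = 1 / 2 → ‖S‖ ≤ 2 * ‖T‖ → ‖c • S‖ₑ ≤ ‖T‖ₑ := by
    intro c S hc hS
    rw [enorm_le_iff_norm_le, norm_smul, hc]
    linarith
  have hadj : ‖T.adj‖ = ‖T‖ := by rw [← toReal_enorm, enorm_adj, toReal_enorm]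
  -- Real and imaginary parts of `T`; the second coefficient is `1 / (2i)`.
  refine ⟨(1 / 2 : ℂ) • (T + T.adj), (-(Complex.I / 2)) • (T - T.adj), ?_, ?_, ?_,
    hbound _ _ (by simp) ((norm_add_le _ _).trans (by linarith)),
    hbound _ _ (by simp) ((norm_sub_le _ _).trans (by linarith))⟩
  · rw [isSelfAdjoint_iff', map_smul, map_add, toCLM_adj, map_smulₛₗ, map_add, adjoint_adjoint,
      add_comm]
    simp [map_ofNat]
  · rw [isSelfAdjoint_iff', map_smul, map_sub, toCLM_adj, map_smulₛₗ, map_sub, adjoint_adjoint,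
      ← neg_sub (toCLM H T), smul_neg, ← neg_smul]
    simp [neg_div, map_ofNat]
  · rw [smul_smul]
    have : Complex.I * -(Complex.I / 2) = 1 / 2 := by
      linear_combination (-1 / 2 : ℂ) * Complex.I_mul_I
    rw [this, ← smul_add]
    have h : T + T.adj + (T - T.adj) = (2 : ℂ) • T := by rw [two_smul]; abel
    rw [h, smul_smul]
    norm_num

/-- Every trace-class operator is a combination of four positive ones, with norm control. -/
theorem exists_isPositive_combination (T : TraceClass H) :
    ∃ A B C D : TraceClass H, A.IsPositive ∧ B.IsPositive ∧ C.IsPositive ∧ D.IsPositive ∧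
      T = A - B + Complex.I • (C - D) ∧
      ‖A‖ₑ ≤ 2 * ‖T‖ₑ ∧ ‖B‖ₑ ≤ 2 * ‖T‖ₑ ∧ ‖C‖ₑ ≤ 2 * ‖T‖ₑ ∧ ‖D‖ₑ ≤ 2 * ‖T‖ₑ := by
  obtain ⟨R, J, hR, hJ, hT, hRn, hJn⟩ := T.exists_selfAdjoint_add
  obtain ⟨A, B, hA, hB, hAB, hAn, hBn⟩ := exists_isPositive_sub hR
  obtain ⟨C, D, hC, hD, hCD, hCn, hDn⟩ := exists_isPositive_sub hJ
  refine ⟨A, B, C, D, hA, hB, hC, hD, by rw [hT, ← hAB, ← hCD], ?_, ?_, ?_, ?_⟩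
  · exact hAn.trans (by gcongr)
  · exact hBn.trans (by gcongr)
  · exact hCn.trans (by gcongr)
  · exact hDn.trans (by gcongr)

/-- A submodule containing all positive trace-class operators is everything. -/
theorem mem_of_isPositive_mem (S : Submodule ℂ (TraceClass H))
    (hS : ∀ T : TraceClass H, T.IsPositive → T ∈ S) (T : TraceClass H) : T ∈ S := by
  obtain ⟨A, B, C, D, hA, hB, hC, hD, rfl, -⟩ := T.exists_isPositive_combination
  exact S.add_mem (S.sub_mem (hS _ hA) (hS _ hB))
    (S.smul_mem _ (S.sub_mem (hS _ hC) (hS _ hD)))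

/-- A linear map that is bounded on positive operators is bounded. -/
theorem norm_le_of_isPositive {E : Type*} [SeminormedAddCommGroup E] [NormedSpace ℂ E]
    (L : TraceClass H →ₗ[ℂ] E) {C : ℝ} (hC : 0 ≤ C)
    (hL : ∀ T : TraceClass H, T.IsPositive → ‖L T‖ ≤ C * ‖T‖) (T : TraceClass H) :
    ‖L T‖ ≤ 8 * C * ‖T‖ := by
  obtain ⟨A, B, D, D', hA, hB, hD, hD', hT, hAn, hBn, hDn, hDn'⟩ := T.exists_isPositive_combination
  have key : ∀ A : TraceClass H, A.IsPositive → ‖A‖ₑ ≤ 2 * ‖T‖ₑ → ‖L A‖ ≤ 2 * (C * ‖T‖) := by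
    intro A hA hAn
    have h : ‖A‖ ≤ 2 * ‖T‖ := by
      have := ENNReal.toReal_mono (ENNReal.mul_ne_top (by simp) enorm_ne_top) hAn
      simpa using this
    calc ‖L A‖ ≤ C * ‖A‖ := hL A hA
      _ ≤ C * (2 * ‖T‖) := by gcongr
      _ = 2 * (C * ‖T‖) := by ring
  have h1 := key A hA hAn
  have h2 := key B hB hBn
  have h3 := key D hD hDn
  have h4 := key D' hD' hDn'
  have h5 : L T = L A - L B + Complex.I • (L D - L D') := by
    conv_lhs => rw [hT]
    simp only [map_add, map_sub, map_smul]
  rw [h5]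
  calc ‖L A - L B + Complex.I • (L D - L D')‖
      ≤ ‖L A - L B‖ + ‖Complex.I • (L D - L D')‖ := norm_add_le _ _
    _ ≤ (‖L A‖ + ‖L B‖) + (‖L D‖ + ‖L D'‖) := by
        rw [norm_smul, Complex.norm_I, one_mul]
        exact add_le_add (norm_sub_le _ _) (norm_sub_le _ _)
    -- Four positive pieces, each of norm at most `2 * ‖T‖`.
    _ ≤ 8 * C * ‖T‖ := by linarith

/-- The product of a trace-class operator and a bounded operator is trace class. -/
theorem traceENorm_comp_ne_top (T : TraceClass H) (a : H →L[ℂ] H) :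
    traceENorm (toCLM H T ∘L a) ≠ ⊤ := by
  -- The `T` for which `T a` is trace class form a subspace, so positive `T` suffice.
  let S : Submodule ℂ (TraceClass H) := (traceClassSubmodule H).comap
    (((ContinuousLinearMap.compL ℂ H H H).flip a).toLinearMap ∘ₗ toCLM H)
  refine mem_of_isPositive_mem S (fun A hA => ?_) T
  refine ne_top_of_le_ne_top ?_ (traceENorm_comp_le_of_isPositive hA a)
  refine ENNReal.mul_ne_top (by finiteness)
    (ne_top_of_le_ne_top A.traceENorm_ne_top (diagSum_le_traceENorm _))

theorem summable_diag {T : H →L[ℂ] H} (hT : traceENorm T ≠ ⊤) :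
    Summable fun k => ⟪hilbertBasis H k, T (hilbertBasis H k)⟫_ℂ := by
  have h := ne_top_of_le_ne_top hT (diagSum_le_traceENorm T)
  have h2 : Summable fun k => ‖⟪hilbertBasis H k, T (hilbertBasis H k)⟫_ℂ‖₊ :=
    ENNReal.tsum_coe_ne_top_iff_summable.mp h
  exact Summable.of_norm (NNReal.summable_coe.mpr h2)

theorem enorm_opTrace_le (T : H →L[ℂ] H) :
    ‖opTrace T‖ₑ ≤ traceENorm T :=
  enorm_tsum_le_tsum_enorm.trans (diagSum_le_traceENorm T)

/-- The pairing with a bounded operator, as a linear functional on trace-class operators. -/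
def pairingL (a : H →L[ℂ] H) : TraceClass H →ₗ[ℂ] ℂ where
  toFun T := T.pairing a
  map_add' S T := by
    have h := (summable_diag (S.traceENorm_comp_ne_top a)).tsum_add
      (summable_diag (T.traceENorm_comp_ne_top a))
    refine Eq.trans ?_ h
    refine tsum_congr fun k => ?_
    rw [map_add, add_comp, add_apply, inner_add_right]
  map_smul' c T := by
    rw [pairing, map_smul, smul_comp, opTrace_smul]
    rfl

/-- The pairing with a bounded operator, as a bounded functional on trace-class operators. -/
def pairingCLM (a : H →L[ℂ] H) : TraceClass H →L[ℂ] ℂ :=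
  (pairingL a).mkContinuous (8 * (1 + ‖a‖ ^ 2))
    (norm_le_of_isPositive (pairingL a) (by positivity) fun T hT => by
      have h := (enorm_opTrace_le _).trans ((traceENorm_comp_le_of_isPositive hT a).trans
        (mul_le_mul_right (diagSum_le_traceENorm _) _))
      have h2 := ENNReal.toReal_mono
        (ENNReal.mul_ne_top (by finiteness) T.traceENorm_ne_top) h
      rw [ENNReal.toReal_mul, ENNReal.toReal_add (by simp) (by finiteness)] at h2
      have h3 : ‖pairingL a T‖ = ‖opTrace (toCLM H T ∘L a)‖ := rfl
      rw [h3]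
      simpa [norm_def] using h2)

theorem pairingCLM_one_apply (T : TraceClass H) : pairingCLM 1 T = T.trace := rfl

/-- Expanding `⟪x, T y⟫` in the fixed basis gives exactly the diagonal series of `T |y⟩⟨x|`. Matrix
entries are thus special pairings, and pairings with rank-one operators determine `T`. -/
theorem pairing_rankOne (T : TraceClass H) (x y : H) :
    T.pairing (InnerProductSpace.rankOne ℂ y x) = entry x y T := by
  rw [entry_apply, ← ((hilbertBasis H).hasSum_inner_mul_inner x (toCLM H T y)).tsum_eq]
  refine tsum_congr fun k => ?_
  rw [comp_apply, InnerProductSpace.rankOne_apply, map_smul, inner_smul_right]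

theorem trace_re_le_norm (T : TraceClass H) : T.trace.re ≤ ‖T‖ := by
  refine (Complex.re_le_norm _).trans ?_
  have h := ENNReal.toReal_mono T.traceENorm_ne_top (enorm_opTrace_le (toCLM H T))
  rwa [toReal_enorm] at h

theorem hasSum_trace (T : TraceClass H) :
    HasSum (fun k => entry (hilbertBasis H k) (hilbertBasis H k) T) T.trace :=
  (summable_diag T.traceENorm_ne_top).hasSum

omit [CompleteSpace H] in
theorem IsPositive.entry_eq {A : TraceClass H} (hA : A.IsPositive) (x : H) :
    entry x x A = ((entry x x A).re : ℂ) :=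
  Complex.eq_re_of_ofReal_le (r := 0) (by rw [Complex.ofReal_zero]; exact hA.inner_nonneg_right x)

omit [CompleteSpace H] in
theorem IsPositive.entry_re_nonneg {A : TraceClass H} (hA : A.IsPositive) (x : H) :
    0 ≤ (entry x x A).re :=
  hA.re_inner_nonneg_right x

omit [CompleteSpace H] in
theorem IsPositive.enorm_entry {A : TraceClass H} (hA : A.IsPositive) (x : H) :
    ‖entry x x A‖ₑ = ENNReal.ofReal (entry x x A).re := by
  rw [hA.entry_eq, ← ofReal_norm, Complex.norm_of_nonneg (hA.entry_re_nonneg x), Complex.ofReal_re]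

theorem IsPositive.diagSum_eq {A : TraceClass H} (hA : A.IsPositive) :
    diagSum (toCLM H A) = ENNReal.ofReal A.trace.re := by
  have h := Complex.hasSum_re A.hasSum_trace
  rw [← h.tsum_eq, ENNReal.ofReal_tsum_of_nonneg (fun k => hA.entry_re_nonneg _) h.summable]
  exact tsum_congr fun k => hA.enorm_entry _

theorem IsPositive.trace_re_nonneg {A : TraceClass H} (hA : A.IsPositive) : 0 ≤ A.trace.re :=
  opTrace_re_nonneg hA

/-- On positive operators the norm is thus controlled by a linear functional, which commutes with
integration. -/
theorem IsPositive.norm_le {A : TraceClass H} (hA : A.IsPositive) : ‖A‖ ≤ 2 * A.trace.re := by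
  have h := traceENorm_le_of_isPositive hA
  rw [hA.diagSum_eq] at h
  have h2 := ENNReal.toReal_mono (by finiteness) h
  rw [ENNReal.toReal_mul, ENNReal.toReal_ofReal hA.trace_re_nonneg] at h2
  simpa [norm_def] using h2

theorem IsPositive.eq_zero_of_trace {A : TraceClass H} (hA : A.IsPositive)
    (h : A.trace.re = 0) : A = 0 := by
  have := hA.norm_le
  rw [h, mul_zero] at this
  exact norm_le_zero_iff.mp this

/-- The rank-one operator `|x⟩⟨y|` as a trace-class operator. -/
def rankOne (x y : H) : TraceClass H :=
  ofCLM (InnerProductSpace.rankOne ℂ x y) <| by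
    refine ne_top_of_le_ne_top (b := ‖x‖ₑ ^ 2 + ‖y‖ₑ ^ 2) (by finiteness)
      (traceENorm_le fun n e f he hf => ?_)
    calc ∑ i, ‖⟪e i, InnerProductSpace.rankOne ℂ x y (f i)⟫_ℂ‖ₑ
        ≤ ∑ i, (‖⟪e i, x⟫_ℂ‖ₑ ^ 2 + ‖⟪f i, y⟫_ℂ‖ₑ ^ 2) := by
          refine Finset.sum_le_sum fun i _ => ?_
          -- AM-GM for two scalars, read as inner-product inequality in the Hilbert space `ℂ`;
          -- Bessel then bounds both sums.
          have h := enorm_inner_le_sq_add_sq (⟪x, e i⟫_ℂ) (⟪y, f i⟫_ℂ)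
          rw [InnerProductSpace.rankOne_apply, inner_smul_right, enorm_mul,
            enorm_inner_symm y (f i), ← enorm_mul]
          rw [enorm_inner_symm x, enorm_inner_symm y] at h
          refine le_trans (le_of_eq ?_) h
          rw [enorm_mul, RCLike.inner_apply, enorm_mul, RCLike.enorm_conj, mul_comm,
            enorm_inner_symm y, enorm_inner_symm x, mul_comm]
      _ ≤ ‖x‖ₑ ^ 2 + ‖y‖ₑ ^ 2 := by
          rw [Finset.sum_add_distrib]
          exact add_le_add (he.sum_enorm_inner_sq_le x) (hf.sum_enorm_inner_sq_le y)

omit [CompleteSpace H] in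
theorem entry_rankOne (u v x y : H) : entry u v (rankOne x y) = ⟪y, v⟫_ℂ * ⟪u, x⟫_ℂ := by
  rw [entry_apply, rankOne, toCLM_ofCLM, InnerProductSpace.rankOne_apply, inner_smul_right]

theorem trace_rankOne (x y : H) : (rankOne x y).trace = ⟪y, x⟫_ℂ := by
  rw [← (rankOne x y).hasSum_trace.tsum_eq, ← ((hilbertBasis H).hasSum_inner_mul_inner y x).tsum_eq]
  exact tsum_congr fun k => entry_rankOne _ _ _ _

end TraceClass
end TraceClassBounds

/-! ### Approximation by finite compressions and separability of the trace class -/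

section Compression

variable {H : Type*} [NormedAddCommGroup H] [InnerProductSpace ℂ H] [CompleteSpace H]

/-- The orthogonal projection onto the span of finitely many vectors of the fixed basis. -/
def basisProj (s : Finset (basisIndex H)) : H →L[ℂ] H :=
  ∑ i ∈ s, InnerProductSpace.rankOne ℂ (hilbertBasis H i) (hilbertBasis H i)

theorem basisProj_apply (s : Finset (basisIndex H)) (x : H) :
    basisProj s x = ∑ i ∈ s, ⟪hilbertBasis H i, x⟫_ℂ • hilbertBasis H i := by
  simp [basisProj, sum_apply]

open Classical in
theorem basisProj_basis (s : Finset (basisIndex H)) (k : basisIndex H) :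
    basisProj s (hilbertBasis H k) = if k ∈ s then hilbertBasis H k else 0 := by
  rw [basisProj_apply]
  simp only [orthonormal_iff_ite.mp (hilbertBasis H).orthonormal, ite_smul, one_smul, zero_smul,
    Finset.sum_ite_eq']

theorem adjoint_basisProj (s : Finset (basisIndex H)) :
    adjoint (basisProj s) = basisProj s := by
  simp [basisProj, map_sum]

theorem hsSum_comp_basisProj_le (X : H →L[ℂ] H) (s : Finset (basisIndex H)) :
    hsSum (X ∘L basisProj s) ≤ hsSum X := by
  classical
  refine ENNReal.tsum_le_tsum fun k => ?_
  rw [comp_apply, basisProj_basis]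
  split_ifs <;> simp

/-- The projection is diagonal in the basis defining the sum, so each basis vector contributes to
just one of the two terms. -/
theorem hsSum_comp_one_sub_basisProj (X : H →L[ℂ] H) (s : Finset (basisIndex H)) :
    hsSum (X ∘L (1 - basisProj s)) + ∑ k ∈ s, ‖X (hilbertBasis H k)‖ₑ ^ 2 = hsSum X := by
  classical
  unfold hsSum
  have h : ∑ k ∈ s, ‖X (hilbertBasis H k)‖ₑ ^ 2 =
      ∑' k, if k ∈ s then ‖X (hilbertBasis H k)‖ₑ ^ 2 else 0 := by
    rw [tsum_eq_sum (s := s) fun k hk => if_neg hk]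
    exact Finset.sum_congr rfl fun k hk => (if_pos hk).symm
  rw [h, ← ENNReal.tsum_add]
  refine tsum_congr fun k => ?_
  rw [comp_apply, sub_apply, basisProj_basis]
  split_ifs <;> simp

/-- Compression of a positive operator to finitely many basis vectors is a good approximation. -/
theorem traceENorm_sub_compression_le (X : H →L[ℂ] H) (s : Finset (basisIndex H))
    {c : ℝ} (hc : 0 < c) :
    traceENorm (adjoint X ∘L X - basisProj s ∘L (adjoint X ∘L X) ∘L basisProj s) ≤
      2 * (ENNReal.ofReal (c ^ 2) * hsSum (X ∘L (1 - basisProj s)) +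
        ENNReal.ofReal ((c⁻¹) ^ 2) * hsSum X) := by
  set P := basisProj s
  have hP : adjoint P = P := adjoint_basisProj s
  have hc' : (c : ℂ) ≠ 0 := by exact_mod_cast hc.ne'
  -- The difference is `X* X(1 - P) + (X(1 - P))* XP`. Each product gets weight `c` on its small
  -- factor `X(1 - P)` and `c⁻¹` on the other, which replaces Cauchy-Schwarz.
  have h1 : adjoint X ∘L X - P ∘L (adjoint X ∘L X) ∘L P =
      adjoint (((c⁻¹ : ℝ) : ℂ) • X) ∘L ((c : ℂ) • (X ∘L (1 - P))) +
      adjoint ((c : ℂ) • (X ∘L (1 - P))) ∘L (((c⁻¹ : ℝ) : ℂ) • (X ∘L P)) := by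
    have e1 : adjoint (1 - P) = 1 - P := by rw [map_sub, hP, ← star_eq_adjoint, star_one]
    rw [map_smulₛₗ, map_smulₛₗ, adjoint_comp, e1]
    ext x
    simp [smul_sub, -Complex.coe_smul, smul_smul, hc']
  have hn : ∀ r : ℝ, 0 < r → ‖(r : ℂ)‖ₑ ^ 2 = ENNReal.ofReal (r ^ 2) := fun r hr => by
    rw [← ofReal_norm, Complex.norm_real, Real.norm_of_nonneg hr.le,
      ENNReal.ofReal_pow hr.le]
  rw [h1]
  refine (traceENorm_add_le _ _).trans
    ((add_le_add (traceENorm_adjoint_comp_le _ _) (traceENorm_adjoint_comp_le _ _)).trans ?_)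
  rw [hsSum_smul, hsSum_smul, hsSum_smul, hn _ hc, hn _ (inv_pos.mpr hc), two_mul]
  have h2 := hsSum_comp_basisProj_le X s
  rw [add_comm (ENNReal.ofReal (c⁻¹ ^ 2) * hsSum X)]
  gcongr

namespace TraceClass

/-- The compression `P T P` of a trace-class operator to finitely many basis vectors. -/
def compress (s : Finset (basisIndex H)) : TraceClass H →L[ℂ] TraceClass H :=
  ∑ i ∈ s, ∑ j ∈ s, (entry (hilbertBasis H i) (hilbertBasis H j)).smulRight
    (rankOne (hilbertBasis H i) (hilbertBasis H j))

theorem compress_apply (s : Finset (basisIndex H)) (T : TraceClass H) :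
    compress s T = ∑ i ∈ s, ∑ j ∈ s, entry (hilbertBasis H i) (hilbertBasis H j) T •
      rankOne (hilbertBasis H i) (hilbertBasis H j) := by
  simp [compress, sum_apply]

theorem toCLM_compress (s : Finset (basisIndex H)) (T : TraceClass H) :
    toCLM H (compress s T) = basisProj s ∘L toCLM H T ∘L basisProj s := by
  ext x
  rw [compress_apply, comp_apply, comp_apply, basisProj_apply, basisProj_apply]
  simp only [map_sum, map_smul, sum_apply, smul_apply, rankOne, toCLM_ofCLM,
    InnerProductSpace.rankOne_apply, inner_sum, inner_smul_right, Finset.sum_smul, entry_apply,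
    smul_smul]
  exact Finset.sum_congr rfl fun i _ => Finset.sum_congr rfl fun j _ => by rw [mul_comm]

theorem trace_compress (s : Finset (basisIndex H)) (T : TraceClass H) :
    (compress s T).trace = ∑ k ∈ s, entry (hilbertBasis H k) (hilbertBasis H k) T := by
  classical
  rw [← pairingCLM_one_apply, compress_apply]
  simp only [map_sum, map_smul, pairingCLM_one_apply, trace_rankOne,
    orthonormal_iff_ite.mp (hilbertBasis H).orthonormal, smul_eq_mul, mul_ite, mul_one, mul_zero]
  exact Finset.sum_congr rfl fun i hi => by rw [Finset.sum_ite_eq' s i, if_pos hi]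

/-- For `A = X* X` the Hilbert-Schmidt sum of `X(1 - P)` is the trace lost by compression. The bound
is linear in the traces for fixed `c`, so it can be integrated pointwise. -/
theorem IsPositive.norm_sub_compress_le {A : TraceClass H} (hA : A.IsPositive)
    (s : Finset (basisIndex H)) {c : ℝ} (hc : 0 < c) :
    ‖A - compress s A‖ ≤
      2 * (c ^ 2 * (A.trace - (compress s A).trace).re + c⁻¹ ^ 2 * A.trace.re) := by
  obtain ⟨X, -, hX⟩ := ContinuousLinearMap.IsPositive.exists_adjoint_comp hA
  have h := traceENorm_sub_compression_le X s hc
  have h1 := hsSum_comp_one_sub_basisProj X s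
  have h2 : hsSum X = ENNReal.ofReal A.trace.re := by rw [hsSum_eq_diagSum, hX, hA.diagSum_eq]
  have h3 : ∑ k ∈ s, ‖X (hilbertBasis H k)‖ₑ ^ 2 = ENNReal.ofReal (compress s A).trace.re := by
    rw [trace_compress, Complex.re_sum,
      ENNReal.ofReal_sum_of_nonneg fun k _ => hA.entry_re_nonneg _]
    refine Finset.sum_congr rfl fun k _ => ?_
    rw [enorm_sq_eq_enorm_inner_adjoint_comp, hX]
    exact hA.enorm_entry _
  have h4 : 0 ≤ (compress s A).trace.re := by
    rw [trace_compress, Complex.re_sum]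
    exact Finset.sum_nonneg fun k _ => hA.entry_re_nonneg _
  rw [h2, h3] at h1
  have h5 : hsSum (X ∘L (1 - basisProj s)) =
      ENNReal.ofReal (A.trace - (compress s A).trace).re := by
    rw [Complex.sub_re, ENNReal.ofReal_sub _ h4, ← h1, ENNReal.add_sub_cancel_right (by finiteness)]
  have h6 : (compress s A).trace.re ≤ A.trace.re := by
    rw [← ENNReal.ofReal_le_ofReal_iff hA.trace_re_nonneg, ← h1]
    exact le_add_self
  rw [hX, h5, h2, ← toCLM_compress, ← map_sub, ← ENNReal.ofReal_mul (by positivity),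
    ← ENNReal.ofReal_mul (by positivity)] at h
  have h7 : 0 ≤ (A.trace - (compress s A).trace).re := by rw [Complex.sub_re]; linarith
  have h8 := hA.trace_re_nonneg
  rw [← ENNReal.ofReal_add (by positivity) (by positivity),
    show (2 : ℝ≥0∞) = ENNReal.ofReal 2 by simp, ← ENNReal.ofReal_mul (by positivity)] at h
  rw [norm_def]
  exact ENNReal.toReal_le_of_le_ofReal (by positivity) h

theorem IsPositive.tendsto_compress {A : TraceClass H} (hA : A.IsPositive) :
    Tendsto (fun s => compress s A) atTop (𝓝 A) := by
  rw [Metric.tendsto_nhds]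
  intro ε hε
  have h8 := hA.trace_re_nonneg
  -- First `c` is taken large to make the term independent of `s` small; then `s` is chosen
  -- depending on `c`.
  obtain ⟨c, hc, hcε⟩ : ∃ c : ℝ, 0 < c ∧ 2 * (c⁻¹ ^ 2 * A.trace.re) < ε / 2 := by
    have h : Tendsto (fun c : ℝ => 2 * (c⁻¹ ^ 2 * A.trace.re)) atTop
        (𝓝 (2 * (0 ^ 2 * A.trace.re))) :=
      (((tendsto_inv_atTop_zero).pow 2).mul_const _).const_mul _
    have h2 := h.eventually_lt_const (u := ε / 2) (by simpa using hε)
    exact ((eventually_gt_atTop 0).and h2).exists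
  have ht : Tendsto (fun s => 2 * (c ^ 2 * (A.trace - (compress s A).trace).re)) atTop
      (𝓝 (2 * (c ^ 2 * (A.trace - A.trace).re))) := by
    refine Tendsto.const_mul _ (Tendsto.const_mul _ ?_)
    refine (Complex.continuous_re.tendsto _).comp (tendsto_const_nhds.sub ?_)
    simp only [trace_compress]
    exact A.hasSum_trace
  have ht2 := ht.eventually_lt_const (u := ε / 2) (by simpa using hε)
  filter_upwards [ht2] with s hs
  rw [dist_comm, dist_eq_norm]
  have := hA.norm_sub_compress_le s hc
  linarith

theorem tendsto_compress (A : TraceClass H) : Tendsto (fun s => compress s A) atTop (𝓝 A) := by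
  let S : Submodule ℂ (TraceClass H) :=
    { carrier := {A | Tendsto (fun s => compress s A) atTop (𝓝 A)}
      add_mem' := fun {A B} hA hB => by
        have h : Tendsto (fun s => compress s A + compress s B) atTop (𝓝 (A + B)) := hA.add hB
        simpa only [Set.mem_ofPred_eq, map_add] using h
      zero_mem' := by simp
      smul_mem' := fun c A hA => by
        have h : Tendsto (fun s => c • compress s A) atTop (𝓝 (c • A)) := hA.const_smul c
        simpa only [Set.mem_ofPred_eq, map_smul] using h }
  exact mem_of_isPositive_mem S (fun T hT => hT.tendsto_compress) A

/-- Consistency of truncations: it identifies the compression of the truncated density `G t` with `G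
s`. -/
theorem compress_sum_rankOne {s t : Finset (basisIndex H)} (hst : s ⊆ t)
    (g : basisIndex H → basisIndex H → ℂ) :
    compress s (∑ i ∈ t, ∑ j ∈ t, g i j • rankOne (hilbertBasis H i) (hilbertBasis H j)) =
      ∑ i ∈ s, ∑ j ∈ s, g i j • rankOne (hilbertBasis H i) (hilbertBasis H j) := by
  classical
  rw [compress_apply]
  refine Finset.sum_congr rfl fun k hk => Finset.sum_congr rfl fun l hl => ?_
  congr 1
  simp only [map_sum, map_smul, entry_rankOne,
    orthonormal_iff_ite.mp (hilbertBasis H).orthonormal, smul_eq_mul, mul_ite, mul_one, mul_zero]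
  simp [Finset.sum_ite_eq, hst hk, hst hl]

/-- Distinct basis vectors are at distance `√2`, so the balls of radius `1 / 2` around them are
disjoint. -/
theorem countable_basisIndex [TopologicalSpace.SeparableSpace H] : Countable (basisIndex H) := by
  have hb := (hilbertBasis H).orthonormal
  refine Pairwise.countable_of_isOpen_disjoint
    (s := fun i => Metric.ball (hilbertBasis H i) (1 / 2)) (fun i j hij => ?_)
    (fun _ => Metric.isOpen_ball) (fun i => Metric.nonempty_ball.mpr (by norm_num))
  refine Metric.ball_disjoint_ball ?_
  rw [dist_eq_norm]
  have h := norm_sub_sq (𝕜 := ℂ) (hilbertBasis H i) (hilbertBasis H j)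
  rw [hb.2 hij, hb.1, hb.1, map_zero] at h
  nlinarith [norm_nonneg (hilbertBasis H i - hilbertBasis H j)]

/-- Compressions lie in the span of countably many rank-one operators and converge to the given
operator. -/
instance [TopologicalSpace.SeparableSpace H] : TopologicalSpace.SeparableSpace (TraceClass H) := by
  have := countable_basisIndex (H := H)
  rw [← TopologicalSpace.isSeparable_univ_iff]
  have h := ((Set.countable_range fun p : basisIndex H × basisIndex H =>
    rankOne (hilbertBasis H p.1) (hilbertBasis H p.2)).isSeparable.span (R := ℂ)).closure
  refine h.mono fun A _ => ?_
  refine mem_closure_of_tendsto A.tendsto_compress (Eventually.of_forall fun s => ?_)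
  rw [compress_apply]
  exact Submodule.sum_mem _ fun i _ => Submodule.sum_mem _ fun j _ =>
    Submodule.smul_mem _ _ (Submodule.subset_span ⟨(i, j), rfl⟩)

end TraceClass

end Compression

/-! ### Radon-Nikodym theorems for complex and positive operator-valued measures -/

section Densities

variable {Ω : Type*} [MeasurableSpace Ω] {Q : Measure Ω}

/-- The Radon-Nikodym theorem for complex measures. -/
theorem exists_density_complexMeasure [SigmaFinite Q] (c : ComplexMeasure Ω)
    (h : ∀ F, MeasurableSet F → Q F = 0 → c F = 0) :
    ∃ g : Ω → ℂ, Integrable g Q ∧ ∀ F, MeasurableSet F → ∫ ω in F, g ω ∂Q = c F := by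
  have key : ∀ s : SignedMeasure Ω, (∀ F, MeasurableSet F → Q F = 0 → s F = 0) →
      ∀ F, MeasurableSet F → ∫ ω in F, s.rnDeriv Q ω ∂Q = s F := fun s hs F hF => by
    have h1 : s ≪ᵥ Q.toENNRealVectorMeasure := VectorMeasure.AbsolutelyContinuous.mk
      fun F hF h0 => hs F hF (by rwa [Measure.toENNRealVectorMeasure_apply_measurable hF] at h0)
    have h2 := (s.absolutelyContinuous_iff_withDensityᵥ_rnDeriv_eq Q).mp h1
    rw [← withDensityᵥ_apply (s.integrable_rnDeriv Q) hF, h2]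
  have hre : ∀ F, c.re F = (c F).re := fun F => rfl
  have him : ∀ F, c.im F = (c F).im := fun F => rfl
  refine ⟨fun ω => (c.re.rnDeriv Q ω : ℂ) + (c.im.rnDeriv Q ω : ℂ) * Complex.I,
    (c.re.integrable_rnDeriv Q).ofReal.add ((c.im.integrable_rnDeriv Q).ofReal.mul_const _),
    fun F hF => ?_⟩
  beta_reduce
  rw [integral_add (c.re.integrable_rnDeriv Q).ofReal.restrict
    ((c.im.integrable_rnDeriv Q).ofReal.mul_const _).restrict, integral_mul_const,
    integral_complex_ofReal, integral_complex_ofReal, key _ (fun F hF h0 => by rw [hre, h F hF h0]; rfl) F hF,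
    key _ (fun F hF h0 => by rw [him, h F hF h0]; rfl) F hF, hre, him]
  exact Complex.re_add_im _

variable {H : Type*} [NormedAddCommGroup H] [InnerProductSpace ℂ H] [CompleteSpace H]

open TraceClass

theorem setIntegral_entry {g : Ω → TraceClass H} (hg : Integrable g Q) (x y : H) (F : Set Ω) :
    ∫ ω in F, entry x y (g ω) ∂Q = entry x y (∫ ω in F, g ω ∂Q) :=
  (entry x y).integral_comp_comm hg.integrableOn

theorem ae_nonneg_complex {φ : Ω → ℂ} (hφ : Integrable φ Q)
    (h : ∀ F, MeasurableSet F → 0 ≤ ∫ ω in F, φ ω ∂Q) : ∀ᵐ ω ∂Q, 0 ≤ φ ω := by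
  have hre : 0 ≤ᵐ[Q] fun ω => (φ ω).re :=
    ae_nonneg_of_forall_setIntegral_nonneg hφ.re fun F hF _ => by
      have h1 := Complex.reCLM.integral_comp_comm hφ.integrableOn (μ := Q.restrict F)
      exact ((Complex.nonneg_iff.mp (h F hF)).1).trans_eq h1.symm
  have him : (fun ω => (φ ω).im) =ᵐ[Q] 0 :=
    Integrable.ae_eq_zero_of_forall_setIntegral_eq_zero hφ.im fun F hF _ => by
      have h1 := Complex.imCLM.integral_comp_comm hφ.integrableOn (μ := Q.restrict F)
      exact h1.trans (Complex.nonneg_iff.mp (h F hF)).2.symm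
  filter_upwards [hre, him] with ω h1 h2
  exact Complex.nonneg_iff.mpr ⟨h1, h2.symm⟩

/-- For fixed `v` the quadratic form is a scalar function with nonnegative set integrals. A
countable dense set of `v` yields a single null set, and continuity covers the remaining `v`. -/
theorem ae_isPositiveBlock [TopologicalSpace.SeparableSpace H] {n : ℕ}
    {g : Fin n → Fin n → Ω → TraceClass H} (hg : ∀ i j, Integrable (g i j) Q)
    (h : ∀ F, MeasurableSet F → IsPositiveBlock fun i j => ∫ ω in F, g i j ω ∂Q) :
    ∀ᵐ ω ∂Q, IsPositiveBlock fun i j => g i j ω := by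
  obtain ⟨D, hDc, hD⟩ := TopologicalSpace.exists_countable_dense (Fin n → H)
  have h1 : ∀ v : Fin n → H, ∀ᵐ ω ∂Q, 0 ≤ ∑ i, ∑ j, entry (v i) (v j) (g i j ω) := fun v => by
    have hi : ∀ i j, Integrable (fun ω => entry (v i) (v j) (g i j ω)) Q := fun i j =>
      (entry (v i) (v j)).integrable_comp (hg i j)
    refine ae_nonneg_complex (integrable_finsetSum _ fun i _ => integrable_finsetSum _
      fun j _ => hi i j) fun F hF => ?_
    rw [integral_finsetSum _ fun i _ => integrable_finsetSum _ fun j _ => (hi i j).integrableOn]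
    refine (h F hF v).trans_eq (Finset.sum_congr rfl fun i _ => ?_)
    rw [integral_finsetSum _ fun j _ => (hi i j).integrableOn]
    exact Finset.sum_congr rfl fun j _ => (setIntegral_entry (hg i j) _ _ F).symm
  filter_upwards [(ae_ball_iff hDc).mpr fun v _ => h1 v] with ω hω
  have hc : IsClosed {v : Fin n → H | 0 ≤ ∑ i, ∑ j, ⟪v i, toCLM H (g i j ω) (v j)⟫_ℂ} := by
    refine isClosed_le continuous_const ?_
    fun_prop
  have h2 := closure_minimal (fun v hv => hω v hv) hc
  rw [hD.closure_eq] at h2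
  exact fun v => h2 (Set.mem_univ v)

theorem ae_isPositive [TopologicalSpace.SeparableSpace H] {g : Ω → TraceClass H}
    (hg : Integrable g Q) (h : ∀ F, MeasurableSet F → (∫ ω in F, g ω ∂Q).IsPositive) :
    ∀ᵐ ω ∂Q, (g ω).IsPositive := by
  have h1 := ae_isPositiveBlock (n := 1) (g := fun _ _ => g) (fun _ _ => hg)
    fun F hF => (h F hF).isPositiveBlock
  filter_upwards [h1] with ω hω
  exact hω.isPositive

/-- The Radon-Nikodym theorem for positive trace-class operator valued measures. -/
theorem exists_density_of_isPositive [SigmaFinite Q] [TopologicalSpace.SeparableSpace H]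
    (m : Set Ω → TraceClass H) (hpos : ∀ F, MeasurableSet F → (m F).IsPositive)
    (hac : ∀ F, MeasurableSet F → Q F = 0 → m F = 0)
    (c : H → H → ComplexMeasure Ω)
    (hc : ∀ x y F, MeasurableSet F → c x y F = entry x y (m F)) :
    ∃ g : Ω → TraceClass H, Integrable g Q ∧ ∀ F, MeasurableSet F → ∫ ω in F, g ω ∂Q = m F := by
  have hex := fun i j : basisIndex H => exists_density_complexMeasure (Q := Q)
    (c (hilbertBasis H i) (hilbertBasis H j)) fun F hF h0 => by
      rw [hc _ _ F hF, hac F hF h0, map_zero]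
  choose γ hγi hγ using hex
  -- The candidate for the compression of the unknown density; a finite sum, hence integrable.
  let G : Finset (basisIndex H) → Ω → TraceClass H := fun s ω =>
    ∑ i ∈ s, ∑ j ∈ s, γ i j ω • rankOne (hilbertBasis H i) (hilbertBasis H j)
  have hGi : ∀ s, Integrable (G s) Q := fun s => integrable_finsetSum _ fun i _ =>
    integrable_finsetSum _ fun j _ => (hγi i j).smul_const _
  have hGint : ∀ s F, MeasurableSet F → ∫ ω in F, G s ω ∂Q = compress s (m F) := by
    intro s F hF
    rw [integral_finsetSum _ fun i _ => integrable_finsetSum _ fun j _ =>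
      ((hγi i j).smul_const _).restrict, compress_apply]
    refine Finset.sum_congr rfl fun i _ => ?_
    rw [integral_finsetSum _ fun j _ => ((hγi i j).smul_const _).restrict]
    refine Finset.sum_congr rfl fun j _ => ?_
    rw [integral_smul_const, hγ i j F hF, hc _ _ F hF]
  have hGpos : ∀ s, ∀ᵐ ω ∂Q, (G s ω).IsPositive := fun s => by
    refine ae_isPositive (hGi s) fun F hF => ?_
    rw [hGint s F hF, TraceClass.IsPositive, toCLM_compress]
    have := ContinuousLinearMap.IsPositive.conj_adjoint (hpos F hF) (basisProj s)
    rwa [adjoint_basisProj] at this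
  have htr : ∀ s, ∫ ω, (G s ω).trace.re ∂Q = (compress s (m Set.univ)).trace.re := fun s => by
    have h1 := (Complex.reCLM ∘L (pairingCLM 1).restrictScalars ℝ).integral_comp_comm (hGi s)
    have h2 := hGint s Set.univ MeasurableSet.univ
    rw [Measure.restrict_univ] at h2
    rw [h2] at h1
    exact h1
  have htri : ∀ s, Integrable (fun ω => (G s ω).trace.re) Q := fun s =>
    (Complex.reCLM ∘L (pairingCLM 1).restrictScalars ℝ).integrable_comp (hGi s)
  set M : ℝ := (m Set.univ).trace.re
  have hA := hpos Set.univ MeasurableSet.univ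
  have hMt : Tendsto (fun s => (compress s (m Set.univ)).trace.re) atTop (𝓝 M) := by
    have := ((Complex.continuous_re.comp (pairingCLM 1).continuous).tendsto _).comp
      (m Set.univ).tendsto_compress
    exact this
  have hMle : ∀ s, (compress s (m Set.univ)).trace.re ≤ M := fun s => by
    refine Monotone.ge_of_tendsto (f := fun s => (compress s (m Set.univ)).trace.re)
      (fun s t hst => ?_) hMt s
    simp only [trace_compress, Complex.re_sum]
    exact Finset.sum_le_sum_of_subset_of_nonneg hst fun k _ _ => hA.entry_re_nonneg _
  -- The compression estimate for `G t ω`, integrated over `Ω`: only traces of compressions of `m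
  -- Set.univ` remain, and the bound is uniform in `t`.
  have hest : ∀ s t, s ⊆ t → ∀ r : ℝ, 0 < r → ∫ ω, ‖G t ω - G s ω‖ ∂Q ≤
      2 * (r ^ 2 * (M - (compress s (m Set.univ)).trace.re) + r⁻¹ ^ 2 * M) := by
    intro s t hst r hr
    have hsub : Integrable (fun ω => (G t ω).trace.re - (G s ω).trace.re) Q :=
      (htri t).sub (htri s)
    calc ∫ ω, ‖G t ω - G s ω‖ ∂Q
        ≤ ∫ ω, 2 * (r ^ 2 * ((G t ω).trace.re - (G s ω).trace.re) +
            r⁻¹ ^ 2 * (G t ω).trace.re) ∂Q := by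
          refine integral_mono_ae ((hGi t).sub (hGi s)).norm
            (((hsub.const_mul _).add ((htri t).const_mul _)).const_mul _) ?_
          filter_upwards [hGpos t] with ω hω
          have h := hω.norm_sub_compress_le s hr
          rw [compress_sum_rankOne hst] at h
          exact h
      _ = 2 * (r ^ 2 * ((compress t (m Set.univ)).trace.re - (compress s (m Set.univ)).trace.re) +
            r⁻¹ ^ 2 * (compress t (m Set.univ)).trace.re) := by
          rw [integral_const_mul, integral_add (hsub.const_mul _)
            ((htri t).const_mul _), integral_const_mul, integral_const_mul,
            integral_sub (htri t) (htri s), htr, htr]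
      _ ≤ _ := by
          have := hMle t
          gcongr
  have hcau : CauchySeq fun s => (hGi s).toL1 (G s) := by
    classical
    refine Metric.cauchySeq_iff'.mpr ?_
    intro ε hε
    obtain ⟨r, hr, hrε⟩ : ∃ r : ℝ, 0 < r ∧ 2 * (r⁻¹ ^ 2 * M) < ε / 2 := by
      have h : Tendsto (fun r : ℝ => 2 * (r⁻¹ ^ 2 * M)) atTop (𝓝 (2 * (0 ^ 2 * M))) :=
        (((tendsto_inv_atTop_zero).pow 2).mul_const _).const_mul _
      have h2 := h.eventually_lt_const (u := ε / 2) (by simpa using hε)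
      exact ((eventually_gt_atTop 0).and h2).exists
    have ht : Tendsto (fun s => 2 * (r ^ 2 * (M - (compress s (m Set.univ)).trace.re))) atTop
        (𝓝 (2 * (r ^ 2 * (M - M)))) :=
      ((tendsto_const_nhds.sub hMt).const_mul _).const_mul _
    obtain ⟨s, hs⟩ := (ht.eventually_lt_const (u := ε / 2) (by simpa using hε)).exists
    refine ⟨s, fun t hst => ?_⟩
    rw [dist_eq_norm, ← Integrable.toL1_sub, L1.norm_of_fun_eq_integral_norm]
    have := hest s t hst r hr
    simp only [Pi.sub_apply]
    linarith
  obtain ⟨g, hg⟩ := cauchySeq_tendsto_of_complete hcau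
  refine ⟨g, L1.integrable_coeFn g, fun F hF => ?_⟩
  -- Set integrals are continuous on L¹, and those of `G s` are compressions of `m F`, which
  -- converge to `m F`.
  refine tendsto_nhds_unique (((continuous_setIntegral F).tendsto g).comp hg) ?_
  refine ((m F).tendsto_compress).congr fun s => ?_
  rw [← hGint s F hF]
  exact integral_congr_ae (ae_restrict_of_ae ((hGi s).coeFn_toL1).symm)

end Densities

/-! ### Integrals against a complex measure with a density -/

section IntegralAgainstDensity

variable {Ω : Type*} [MeasurableSpace Ω] {Q : Measure Ω}

/-- This domination gives both finiteness of the variation and its absolute continuity with respect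
to `Q`. -/
theorem variation_le_withDensity {c : ComplexMeasure Ω} {g : Ω → ℂ}
    (hc : ∀ F, MeasurableSet F → ∫ ω in F, g ω ∂Q = c F) :
    c.variation ≤ Q.withDensity fun ω => ‖g ω‖ₑ := by
  refine VectorMeasure.variation_le_of_forall_enorm_le fun F hF => ?_
  rw [← hc F hF, withDensity_apply _ hF]
  exact enorm_integral_le_lintegral_enorm _

theorem isFiniteMeasure_variation {c : ComplexMeasure Ω} {g : Ω → ℂ} (hg : Integrable g Q)
    (hc : ∀ F, MeasurableSet F → ∫ ω in F, g ω ∂Q = c F) : IsFiniteMeasure c.variation := by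
  have : IsFiniteMeasure (Q.withDensity fun ω => ‖g ω‖ₑ) :=
    isFiniteMeasure_withDensity hg.2.ne
  exact isFiniteMeasure_of_le _ (variation_le_withDensity hc)

theorem variation_absolutelyContinuous {c : ComplexMeasure Ω} {g : Ω → ℂ}
    (hc : ∀ F, MeasurableSet F → ∫ ω in F, g ω ∂Q = c F) : c.variation ≪ Q :=
  (Measure.absolutelyContinuous_of_le (variation_le_withDensity hc)).trans
    (withDensity_absolutelyContinuous _ _)

theorem integral_indicator_complexMeasure {c : ComplexMeasure Ω} [IsFiniteMeasure c.variation]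
    {F : Set Ω} (hF : MeasurableSet F) (a : ℂ) :
    c.integral (F.indicator fun _ => a) (ContinuousLinearMap.mul ℝ ℂ) = a * c F := by
  rw [VectorMeasure.integral_indicator hF, VectorMeasure.setIntegral_const]
  rfl

theorem integral_simpleFunc_of_density {c : ComplexMeasure Ω} {g : Ω → ℂ} (hg : Integrable g Q)
    (hc : ∀ F, MeasurableSet F → ∫ ω in F, g ω ∂Q = c F) (f : SimpleFunc Ω ℂ) :
    c.integral f (ContinuousLinearMap.mul ℝ ℂ) = ∫ ω, f ω * g ω ∂Q := by
  have := isFiniteMeasure_variation hg hc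
  have hint : ∀ f : SimpleFunc Ω ℂ, Integrable (fun ω => f ω * g ω) Q := fun f => by
    obtain ⟨C, hC⟩ := f.exists_forall_norm_le
    exact hg.bdd_mul f.stronglyMeasurable.aestronglyMeasurable (Eventually.of_forall hC)
  induction f using SimpleFunc.induction with
  | const a hF =>
    rename_i F
    have h1 : ⇑(SimpleFunc.piecewise F hF (SimpleFunc.const Ω a) (SimpleFunc.const Ω 0)) =
        F.indicator fun _ => a := by
      ext ω
      simp [Set.indicator, Set.piecewise]
    rw [h1, integral_indicator_complexMeasure hF, ← hc F hF, ← integral_const_mul,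
      ← integral_indicator hF]
    refine integral_congr_ae (Eventually.of_forall fun ω => ?_)
    by_cases h : ω ∈ F <;> simp [h]
  | add hd h1 h2 =>
    rename_i f₁ f₂
    rw [SimpleFunc.coe_add, VectorMeasure.integral_add f₁.integrable_of_isFiniteMeasure
      f₂.integrable_of_isFiniteMeasure, h1, h2, ← integral_add (hint f₁) (hint f₂)]
    exact integral_congr_ae (Eventually.of_forall fun ω => by simp [add_mul])

/-- Integration against a complex measure with a density. -/
theorem integral_of_density {c : ComplexMeasure Ω} {g : Ω → ℂ} (hg : Integrable g Q)
    (hc : ∀ F, MeasurableSet F → ∫ ω in F, g ω ∂Q = c F) (f : Lp ℂ ∞ Q) :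
    c.integral f (ContinuousLinearMap.mul ℝ ℂ) = ∫ ω, f ω * g ω ∂Q := by
  have := isFiniteMeasure_variation hg hc
  have hb : ∀ᵐ ω ∂Q, ‖f ω‖ ≤ ‖f‖ := by
    filter_upwards [ae_le_eLpNormEssSup (f := f) (μ := Q)] with ω hω
    rwa [← eLpNorm_exponent_top, ← Lp.enorm_def, enorm_le_iff_norm_le] at hω
  have hf : StronglyMeasurable f := Lp.stronglyMeasurable f
  -- Simple functions uniformly bounded by `‖f‖`, so that dominated convergence applies to both
  -- integrals.
  have hlim : ∀ᵐ ω ∂Q, Tendsto (fun n => hf.approxBounded ‖f‖ n ω) atTop (𝓝 (f ω)) :=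
    hf.tendsto_approxBounded_ae hb
  have hbd : ∀ n ω, ‖hf.approxBounded ‖f‖ n ω‖ ≤ ‖f‖ :=
    fun n ω => hf.norm_approxBounded_le (norm_nonneg f) n ω
  have h1 : Tendsto (fun n => c.integral (hf.approxBounded ‖f‖ n) (ContinuousLinearMap.mul ℝ ℂ))
      atTop (𝓝 (c.integral f (ContinuousLinearMap.mul ℝ ℂ))) :=
    VectorMeasure.tendsto_integral_filter_of_norm_le_const
      (Eventually.of_forall fun n => (hf.approxBounded ‖f‖ n).stronglyMeasurable.aestronglyMeasurable)
      ⟨‖f‖, Eventually.of_forall fun n => Eventually.of_forall (hbd n)⟩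
      ((variation_absolutelyContinuous hc).ae_le hlim)
  have h2 : Tendsto (fun n => ∫ ω, hf.approxBounded ‖f‖ n ω * g ω ∂Q) atTop
      (𝓝 (∫ ω, f ω * g ω ∂Q)) := by
    refine tendsto_integral_of_dominated_convergence (fun ω => ‖f‖ * ‖g ω‖) (fun n => ?_)
      (hg.norm.const_mul _) (fun n => Eventually.of_forall fun ω => ?_) ?_
    · exact (hf.approxBounded ‖f‖ n).stronglyMeasurable.aestronglyMeasurable.mul hg.1
    · rw [norm_mul]
      exact mul_le_mul_of_nonneg_right (hbd n ω) (norm_nonneg _)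
    · filter_upwards [hlim] with ω hω using hω.mul_const _
  simp only [integral_simpleFunc_of_density hg hc] at h1
  exact tendsto_nhds_unique h1 h2

end IntegralAgainstDensity

/-! ### Densities of instruments, the preadjoint channel and a posteriori states -/

section InstrumentDensities

variable {H : Type*} [NormedAddCommGroup H] [InnerProductSpace ℂ H] [CompleteSpace H]
variable {H₁ : Type*} [NormedAddCommGroup H₁] [InnerProductSpace ℂ H₁] [CompleteSpace H₁]
variable {H₂ : Type*} [NormedAddCommGroup H₂] [InnerProductSpace ℂ H₂] [CompleteSpace H₂]
variable {Ω : Type*} [MeasurableSpace Ω] {Q : Measure Ω}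

open TraceClass

/-- A positive trace-class operator of nonzero trace is a multiple of a density operator. -/
theorem TraceClass.IsPositive.exists_densityOperator {A : TraceClass H} (hA : A.IsPositive)
    (h : 0 < A.trace.re) : ∃ τ : DensityOperator H, A = A.trace • τ.toTraceClass := by
  have hre : A.trace = (A.trace.re : ℂ) := opTrace_eq_re hA
  have hne : A.trace ≠ 0 := fun h1 => by rw [h1] at h; simp at h
  refine ⟨⟨A.trace⁻¹ • A, ?_, ?_⟩, (smul_inv_smul₀ hne A).symm⟩
  · have h0 : (0 : ℂ) ≤ A.trace⁻¹ := by
      rw [hre, ← Complex.ofReal_inv, Complex.zero_le_real]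
      exact inv_nonneg.mpr h.le
    rw [TraceClass.IsPositive, map_smul]
    exact ContinuousLinearMap.IsPositive.smul_of_nonneg hA h0
  · rw [← pairingCLM_one_apply, map_smul, pairingCLM_one_apply]
    exact inv_mul_cancel₀ hne

theorem DensityOperator.normalize_of_pos (τ : DensityOperator H) {T : TraceClass H}
    (hT : T.IsPositive) (h : 0 < T.trace.re) :
    (τ.normalize T hT).toTraceClass = T.trace⁻¹ • T :=
  congrArg DensityOperator.toTraceClass (dif_pos h)

theorem DensityOperator.normalize_of_not_pos (τ : DensityOperator H) {T : TraceClass H}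
    (hT : T.IsPositive) (h : ¬ 0 < T.trace.re) : τ.normalize T hT = τ :=
  dif_neg h

theorem DensityOperator.isPositive (τ : DensityOperator H) : τ.toTraceClass.IsPositive := τ.2.1

theorem DensityOperator.trace_eq_one (τ : DensityOperator H) : τ.toTraceClass.trace = 1 := τ.2.2

theorem DensityOperator.norm_le (τ : DensityOperator H) : ‖τ.toTraceClass‖ ≤ 2 := by
  have h := τ.isPositive.norm_le
  rw [τ.trace_eq_one] at h
  simpa using h

/-- Where the trace vanishes, the positive operator itself is zero, so the choice of `τ` does not
matter. -/
theorem DensityOperator.trace_re_smul_normalize (τ : DensityOperator H) {T : TraceClass H}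
    (hT : T.IsPositive) : T.trace.re • (τ.normalize T hT).toTraceClass = T := by
  by_cases h : 0 < T.trace.re
  · have hre : T.trace = (T.trace.re : ℂ) := opTrace_eq_re hT
    rw [τ.normalize_of_pos hT h, ← Complex.coe_smul, ← hre]
    exact smul_inv_smul₀ (fun h1 => by rw [h1] at h; simp at h) T
  · have h0 : T.trace.re = 0 := le_antisymm (not_lt.mp h) hT.trace_re_nonneg
    rw [h0, zero_smul, hT.eq_zero_of_trace h0]

namespace Instrument

variable (I : Instrument H₁ H₂ Ω)

theorem pairingMeasure_apply (ρ : TraceClass H₁) (a : H₂ →L[ℂ] H₂) {F : Set Ω}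
    (hF : MeasurableSet F) : I.pairingMeasure ρ a F = (I.toFun F ρ).pairing a := if_pos hF

/-- After scaling `ρ` to a state, absolute continuity kills the trace of `I(F)[ρ]`; positivity then
kills the operator. -/
theorem toFun_eq_zero_of_null (hQ : ∀ ρ : DensityOperator H₁, I.prob ρ ≪ Q)
    {ρ : TraceClass H₁} (hρ : ρ.IsPositive) {F : Set Ω} (hF : MeasurableSet F) (h0 : Q F = 0) :
    I.toFun F ρ = 0 := by
  by_cases h : 0 < ρ.trace.re
  · obtain ⟨τ, hτ⟩ := hρ.exists_densityOperator h
    have h1 := hQ τ h0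
    rw [I.prob_apply τ hF, ENNReal.ofReal_eq_zero] at h1
    have h2 := I.isPositive_apply hF τ.isPositive
    rw [hτ, map_smul, h2.eq_zero_of_trace (le_antisymm h1 h2.trace_re_nonneg), smul_zero]
  · rw [hρ.eq_zero_of_trace (le_antisymm (not_lt.mp h) hρ.trace_re_nonneg), map_zero]

/-- `g` is a density with respect to `Q` of the vector measure `F ↦ I(F)[ρ]`. -/
def HasDensity (Q : Measure Ω) (ρ : TraceClass H₁) (g : Ω → TraceClass H₂) : Prop :=
  Integrable g Q ∧ ∀ F, MeasurableSet F → ∫ ω in F, g ω ∂Q = I.toFun F ρ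

variable {I}

theorem HasDensity.congr {ρ : TraceClass H₁} {g g' : Ω → TraceClass H₂} (h : I.HasDensity Q ρ g)
    (hg : g =ᵐ[Q] g') : I.HasDensity Q ρ g' :=
  ⟨h.1.congr hg, fun F hF => (integral_congr_ae (ae_restrict_of_ae hg.symm)).trans (h.2 F hF)⟩

theorem HasDensity.ae_eq {ρ : TraceClass H₁} {g g' : Ω → TraceClass H₂} (h : I.HasDensity Q ρ g)
    (h' : I.HasDensity Q ρ g') : g =ᵐ[Q] g' :=
  h.1.ae_eq_of_forall_setIntegral_eq _ _ h'.1 fun F hF _ => (h.2 F hF).trans (h'.2 F hF).symm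

theorem HasDensity.add {ρ ρ' : TraceClass H₁} {g g' : Ω → TraceClass H₂}
    (h : I.HasDensity Q ρ g) (h' : I.HasDensity Q ρ' g') :
    I.HasDensity Q (ρ + ρ') (g + g') :=
  ⟨h.1.add h'.1, fun F hF => by
    rw [map_add, ← h.2 F hF, ← h'.2 F hF]
    exact integral_add h.1.restrict h'.1.restrict⟩

theorem HasDensity.smul (c : ℂ) {ρ : TraceClass H₁} {g : Ω → TraceClass H₂}
    (h : I.HasDensity Q ρ g) : I.HasDensity Q (c • ρ) (c • g) :=
  ⟨h.1.smul c, fun F hF => by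
    rw [map_smul, ← h.2 F hF]
    exact integral_smul c g⟩

theorem hasDensity_zero : I.HasDensity Q 0 0 :=
  ⟨integrable_zero _ _ _, fun F _ => by simp⟩

theorem HasDensity.setIntegral_pairing {ρ : TraceClass H₁} {g : Ω → TraceClass H₂}
    (h : I.HasDensity Q ρ g) (a : H₂ →L[ℂ] H₂) {F : Set Ω} (hF : MeasurableSet F) :
    ∫ ω in F, (g ω).pairing a ∂Q = (I.toFun F ρ).pairing a := by
  have h1 := (pairingCLM a).integral_comp_comm h.1.restrict (μ := Q.restrict F)
  rw [h.2 F hF] at h1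
  exact h1

theorem HasDensity.integral_trace {ρ : TraceClass H₁} {g : Ω → TraceClass H₂}
    (h : I.HasDensity Q ρ g) : ∫ ω, (g ω).trace ∂Q = ρ.trace := by
  have h1 := h.setIntegral_pairing 1 MeasurableSet.univ
  rw [Measure.restrict_univ] at h1
  exact h1.trans (I.normalized ρ)

theorem HasDensity.integrable_trace_re {ρ : TraceClass H₁} {g : Ω → TraceClass H₂}
    (h : I.HasDensity Q ρ g) : Integrable (fun ω => (g ω).trace.re) Q :=
  ((pairingCLM 1).integrable_comp h.1).re

theorem HasDensity.setIntegral_trace_re {ρ : TraceClass H₁} {g : Ω → TraceClass H₂}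
    (h : I.HasDensity Q ρ g) {F : Set Ω} (hF : MeasurableSet F) :
    ∫ ω in F, (g ω).trace.re ∂Q = (I.toFun F ρ).trace.re := by
  rw [← pairing_one, ← h.setIntegral_pairing 1 hF]
  exact Complex.reCLM.integral_comp_comm ((pairingCLM 1).integrable_comp h.1).restrict

theorem HasDensity.ae_isPositive [TopologicalSpace.SeparableSpace H₂] {ρ : TraceClass H₁}
    {g : Ω → TraceClass H₂} (h : I.HasDensity Q ρ g) (hρ : ρ.IsPositive) :
    ∀ᵐ ω ∂Q, (g ω).IsPositive :=
  _root_.ae_isPositive h.1 fun F hF => by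
    rw [h.2 F hF]
    exact I.isPositive_apply hF hρ

/-- Inputs admitting a density form a subspace, and positive inputs belong to it by the
Radon-Nikodym theorem. -/
theorem exists_hasDensity [SigmaFinite Q] [TopologicalSpace.SeparableSpace H₂]
    (hQ : ∀ ρ : DensityOperator H₁, I.prob ρ ≪ Q) (ρ : TraceClass H₁) :
    ∃ g, I.HasDensity Q ρ g := by
  let S : Submodule ℂ (TraceClass H₁) :=
    { carrier := {ρ | ∃ g, I.HasDensity Q ρ g}
      add_mem' := fun ⟨g, hg⟩ ⟨g', hg'⟩ => ⟨g + g', hg.add hg'⟩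
      zero_mem' := ⟨0, hasDensity_zero⟩
      smul_mem' := fun c _ ⟨g, hg⟩ => ⟨c • g, hg.smul c⟩ }
  refine mem_of_isPositive_mem S (fun ρ hρ => ?_) ρ
  exact exists_density_of_isPositive (fun F => I.toFun F ρ)
    (fun F hF => I.isPositive_apply hF hρ) (fun F hF h0 => I.toFun_eq_zero_of_null hQ hρ hF h0)
    (fun x y => I.pairingMeasure ρ (InnerProductSpace.rankOne ℂ y x)) fun x y F hF => by
      rw [I.pairingMeasure_apply _ _ hF, pairing_rankOne]

/-- The bounded linear map sending `ρ` to the density of `F ↦ I(F)[ρ]`. -/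
theorem exists_density_map [SigmaFinite Q] [TopologicalSpace.SeparableSpace H₂]
    (hQ : ∀ ρ : DensityOperator H₁, I.prob ρ ≪ Q) :
    ∃ Λ : TraceClass H₁ →L[ℂ] Lp (TraceClass H₂) 1 Q, ∀ ρ, I.HasDensity Q ρ (Λ ρ) := by
  choose g hg using fun ρ => exists_hasDensity (I := I) hQ ρ
  let L : TraceClass H₁ → Lp (TraceClass H₂) 1 Q := fun ρ => (hg ρ).1.toL1 (g ρ)
  have hL : ∀ ρ, I.HasDensity Q ρ (L ρ) := fun ρ =>
    (hg ρ).congr ((hg ρ).1.coeFn_toL1).symm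
  let Λ : TraceClass H₁ →ₗ[ℂ] Lp (TraceClass H₂) 1 Q :=
    { toFun := L
      -- Both sides are densities of the same vector measure, hence equal almost everywhere.
      map_add' := fun ρ ρ' => Lp.ext <| (hL _).ae_eq
        (((hL ρ).add (hL ρ')).congr (Lp.coeFn_add _ _).symm)
      map_smul' := fun c ρ => Lp.ext <| (hL _).ae_eq
        (((hL ρ).smul c).congr (Lp.coeFn_smul _ _).symm) }
  have hbound : ∀ ρ : TraceClass H₁, ρ.IsPositive → ‖Λ ρ‖ ≤ 2 * ‖ρ‖ := fun ρ hρ => by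
    calc ‖Λ ρ‖ = ∫ ω, ‖L ρ ω‖ ∂Q := L1.norm_eq_integral_norm _
      _ ≤ ∫ ω, 2 * (L ρ ω).trace.re ∂Q := by
          refine integral_mono_ae (hL ρ).1.norm ((hL ρ).integrable_trace_re.const_mul _) ?_
          filter_upwards [(hL ρ).ae_isPositive hρ] with ω hω using hω.norm_le
      _ = 2 * ρ.trace.re := by
          have h := (hL ρ).setIntegral_trace_re MeasurableSet.univ
          rw [Measure.restrict_univ, I.normalized] at h
          rw [integral_const_mul, h]
      _ ≤ 2 * ‖ρ‖ := by
          have := ρ.trace_re_le_norm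
          gcongr
  exact ⟨Λ.mkContinuous _ (norm_le_of_isPositive Λ zero_le_two hbound), hL⟩

theorem HasDensity.integral_mul_pairing {ρ : TraceClass H₁} {g : Ω → TraceClass H₂}
    (h : I.HasDensity Q ρ g) (a : H₂ →L[ℂ] H₂) (f : Lp ℂ ∞ Q) :
    ∫ ω, f ω * (g ω).pairing a ∂Q =
      (I.pairingMeasure ρ a).integral f (ContinuousLinearMap.mul ℝ ℂ) :=
  (integral_of_density ((pairingCLM a).integrable_comp h.1) (fun F hF => by
    rw [I.pairingMeasure_apply _ _ hF]
    exact h.setIntegral_pairing a hF) f).symm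

theorem isPreadjointChannel_of_hasDensity [TopologicalSpace.SeparableSpace H₂]
    {Λ : TraceClass H₁ →L[ℂ] Lp (TraceClass H₂) 1 Q} (hΛ : ∀ ρ, I.HasDensity Q ρ (Λ ρ)) :
    I.IsPreadjointChannel Q Λ where
  completelyPositive n T hT := ae_isPositiveBlock (fun i j => (hΛ (T i j)).1) fun F hF => by
    simp only [(hΛ _).2 F hF]
    exact I.completelyPositive F hF n T hT
  normalized ρ := (hΛ ρ).integral_trace
  pairing_eq ρ a f := (hΛ ρ).integral_mul_pairing a f

/-- Testing the duality with indicators and rank-one operators recovers every matrix entry of the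
integral over `F`. A known density `g` turns the integral against the complex measure into one
against `Q`. -/
theorem IsPreadjointChannel.hasDensity [SigmaFinite Q] [TopologicalSpace.SeparableSpace H₂]
    (hQ : ∀ ρ : DensityOperator H₁, I.prob ρ ≪ Q)
    {Λ : TraceClass H₁ →L[ℂ] Lp (TraceClass H₂) 1 Q} (hΛ : I.IsPreadjointChannel Q Λ)
    (ρ : TraceClass H₁) : I.HasDensity Q ρ (Λ ρ) := by
  obtain ⟨g, hg⟩ := exists_hasDensity hQ ρ
  have hi := L1.integrable_coeFn (Λ ρ)
  refine ⟨hi, fun F hF => ext_entry fun x y => ?_⟩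
  have hm : MemLp (F.indicator fun _ => (1 : ℂ)) ∞ Q := (memLp_top_const 1).indicator hF
  have hcongr : ∀ φ : Ω → ℂ, ∫ ω, hm.toLp _ ω * φ ω ∂Q = ∫ ω in F, φ ω ∂Q := fun φ => by
    rw [← integral_indicator hF]
    refine integral_congr_ae ?_
    filter_upwards [hm.coeFn_toLp] with ω hω
    rw [hω]
    by_cases h : ω ∈ F <;> simp [h]
  have h1 := hΛ.pairing_eq ρ (InnerProductSpace.rankOne ℂ y x) (hm.toLp _)
  rw [← hg.integral_mul_pairing, hcongr, hcongr, hg.setIntegral_pairing _ hF] at h1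
  simp only [pairing_rankOne] at h1
  rw [← h1, setIntegral_entry hi]

theorem HasDensity.prob_eq_withDensity [TopologicalSpace.SeparableSpace H₂]
    {ρ : DensityOperator H₁} {g : Ω → TraceClass H₂}
    (h : I.HasDensity Q ρ.toTraceClass g) :
    I.prob ρ = Q.withDensity fun ω => ENNReal.ofReal (g ω).trace.re := by
  ext F hF
  rw [I.prob_apply ρ hF, withDensity_apply _ hF, ← h.setIntegral_trace_re hF,
    ofReal_integral_eq_lintegral_ofReal h.integrable_trace_re.restrict]
  refine ae_restrict_of_ae ?_
  filter_upwards [h.ae_isPositive ρ.isPositive] with ω hω using hω.trace_re_nonneg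

variable (I) in
theorem isProbabilityMeasure_prob (ρ : DensityOperator H₁) : IsProbabilityMeasure (I.prob ρ) := by
  constructor
  rw [I.prob_apply ρ MeasurableSet.univ, I.normalized, ρ.trace_eq_one]
  simp

theorem HasDensity.isAPosteriori [Q.IsComplete] [TopologicalSpace.SeparableSpace H₂]
    {ρ : DensityOperator H₁} {S : Ω → TraceClass H₂} (h : I.HasDensity Q ρ.toTraceClass S)
    (hS : ∀ ω, (S ω).IsPositive) (τ : DensityOperator H₂) :
    I.IsAPosteriori ρ fun ω => τ.normalize (S ω) (hS ω) := by
  have := I.isProbabilityMeasure_prob ρ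
  -- `S` is only almost everywhere equal to a measurable function; completeness of `Q` makes it
  -- measurable, and separability of the trace class makes it strongly measurable.
  have hSm : StronglyMeasurable S := by
    borelize (TraceClass H₂)
    have : SecondCountableTopology (TraceClass H₂) := UniformSpace.secondCountable_of_separable _
    exact (h.1.1.stronglyMeasurable_mk.measurable.congr_ae h.1.1.ae_eq_mk.symm).stronglyMeasurable
  have htm : StronglyMeasurable fun ω => (S ω).trace :=
    (pairingCLM 1).continuous.comp_stronglyMeasurable hSm
  have htr : Measurable fun ω => (S ω).trace.re := Complex.measurable_re.comp htm.measurable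
  have hm : StronglyMeasurable fun ω => (τ.normalize (S ω) (hS ω)).toTraceClass := by
    classical
    have h1 : (fun ω => (τ.normalize (S ω) (hS ω)).toTraceClass) = fun ω =>
        if 0 < (S ω).trace.re then (S ω).trace⁻¹ • S ω else τ.toTraceClass := by
      ext1 ω
      split_ifs with h0
      · exact τ.normalize_of_pos (hS ω) h0
      · rw [τ.normalize_of_not_pos (hS ω) h0]
    rw [h1]
    exact StronglyMeasurable.ite (measurableSet_lt measurable_const htr)
      (htm.measurable.inv.stronglyMeasurable.smul hSm) stronglyMeasurable_const
  refine ⟨hm, ?_, fun F hF => ?_⟩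
  · exact Integrable.of_bound hm.aestronglyMeasurable 2
      (Eventually.of_forall fun ω => DensityOperator.norm_le _)
  -- Since `P_ρ` has density `Tr S`, the integrand becomes `(Tr S) π = S`.
  · rw [h.prob_eq_withDensity, restrict_withDensity hF,
      integral_withDensity_eq_integral_toReal_smul htr.ennreal_ofReal
        (Eventually.of_forall fun _ => ENNReal.ofReal_lt_top), ← h.2 F hF]
    refine integral_congr_ae (Eventually.of_forall fun ω => ?_)
    simp only
    rw [ENNReal.toReal_ofReal (hS ω).trace_re_nonneg, τ.trace_re_smul_normalize]

theorem IsAPosteriori.ae_eq {ρ : DensityOperator H₁} {π π' : Ω → DensityOperator H₂}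
    (h : I.IsAPosteriori ρ π) (h' : I.IsAPosteriori ρ π') : π' =ᵐ[I.prob ρ] π := by
  have h1 := h'.integrable.ae_eq_of_forall_setIntegral_eq _ _ h.integrable fun F hF _ =>
    (h'.setIntegral_eq F hF).trans (h.setIntegral_eq F hF).symm
  filter_upwards [h1] with ω hω using Subtype.ext hω

/-- Setting the density to zero wherever it fails to be positive changes it only on a null set. -/
theorem HasDensity.exists_isPositive_representative [TopologicalSpace.SeparableSpace H₂]
    {ρ : TraceClass H₁} {g : Ω → TraceClass H₂} (h : I.HasDensity Q ρ g) (hρ : ρ.IsPositive) :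
    ∃ S : Ω → TraceClass H₂, S =ᵐ[Q] g ∧ ∀ ω, (S ω).IsPositive := by
  classical
  refine ⟨fun ω => if (g ω).IsPositive then g ω else 0, ?_, fun ω => ?_⟩
  · filter_upwards [h.ae_isPositive hρ] with ω hω using if_pos hω
  · beta_reduce
    split_ifs with h0
    · exact h0
    · rw [TraceClass.IsPositive, map_zero]
      exact ContinuousLinearMap.isPositive_zero

variable (I) in
/-- The total output state of an instrument. -/
def output (ρ : DensityOperator H₁) : DensityOperator H₂ :=
  ⟨I.toFun Set.univ ρ.toTraceClass, I.isPositive_apply MeasurableSet.univ ρ.isPositive,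
    (I.normalized _).trans ρ.trace_eq_one⟩

end Instrument

end InstrumentDensities

end

/-! ### The main theorem -/

theorem mainTheorem2
    {H₁ : Type*} [NormedAddCommGroup H₁] [InnerProductSpace ℂ H₁] [CompleteSpace H₁]
    [TopologicalSpace.SeparableSpace H₁]
    {H₂ : Type*} [NormedAddCommGroup H₂] [InnerProductSpace ℂ H₂] [CompleteSpace H₂]
    [TopologicalSpace.SeparableSpace H₂]
    {Ω : Type*} [MeasurableSpace Ω] (Q : Measure Ω) [SigmaFinite Q] [Q.IsComplete]
    (I : Instrument H₁ H₂ Ω) (hQ : ∀ ρ : DensityOperator H₁, I.prob ρ ≪ Q) :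
    (∀ ρ : DensityOperator H₁, ∃ π : Ω → DensityOperator H₂,
      I.IsAPosteriori ρ π ∧
      ∀ π' : Ω → DensityOperator H₂, I.IsAPosteriori ρ π' → π' =ᵐ[I.prob ρ] π) ∧
    ∃ Λ : TraceClass H₁ →L[ℂ] Lp (TraceClass H₂) 1 Q,
      I.IsPreadjointChannel Q Λ ∧
      (∀ Λ' : TraceClass H₁ →L[ℂ] Lp (TraceClass H₂) 1 Q,
        I.IsPreadjointChannel Q Λ' → Λ' = Λ) ∧
      ∀ ρ : DensityOperator H₁,
        (∃ S : Ω → TraceClass H₂, S =ᵐ[Q] Λ ρ.toTraceClass ∧ ∀ ω, (S ω).IsPositive) ∧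
        ∀ (S : Ω → TraceClass H₂) (hS : ∀ ω, (S ω).IsPositive) (τ : DensityOperator H₂),
          S =ᵐ[Q] Λ ρ.toTraceClass →
          I.IsAPosteriori ρ fun ω => τ.normalize (S ω) (hS ω) := by
  obtain ⟨Λ, hΛ⟩ := Instrument.exists_density_map hQ
  refine ⟨fun ρ => ?_, Λ, Instrument.isPreadjointChannel_of_hasDensity hΛ, fun Λ' hΛ' => ?_,
    fun ρ => ⟨(hΛ _).exists_isPositive_representative ρ.isPositive, fun S hS τ hSΛ =>
      ((hΛ _).congr hSΛ.symm).isAPosteriori hS τ⟩⟩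
  · obtain ⟨S, hSΛ, hS⟩ := (hΛ ρ.toTraceClass).exists_isPositive_representative ρ.isPositive
    -- Any state serves as the fallback value; the output state shows that one exists.
    have h := ((hΛ _).congr hSΛ.symm).isAPosteriori hS (I.output ρ)
    exact ⟨_, h, fun π' hπ' => h.ae_eq hπ'⟩
  · exact ContinuousLinearMap.ext fun ρ => Lp.ext ((hΛ'.hasDensity hQ ρ).ae_eq (hΛ ρ))
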